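/- Let $\delta\in\{1,-1\}$ and let $\mathcal N=\{X\in\mathbb R^{n\times n}: X^TX=I_n,\ \det X=\delta\}$, a smooth submanifold of $\mathbb R^{n\times n}$. A subset $S\subseteq\mathcal N$ is said to have codimension $c$ in $\mathcal N$ if $S$ is a finite disjoint union of smooth embedded submanifolds, all of dimension at most $\dim\mathcal N-c$, and at least one of them nonempty of dimension exactly $\dim\mathcal N-c$ (if $S$ is itself a nonempty submanifold, this means $\dim\mathcal N-\dim S=c$). A matrix is derogatory if one of its complex eigenvalues has geometric multiplicity greater than $1$; a double eigenvalue is a complex eigenvalue of algebraic multiplicity at least $2$. The set of derogatory matrices in $\mathcal N$ has codimension in $\mathcal N$ equal to - $1$ if $n\ge 2$ is even and $\delta=1$; - $3$ if $n\ge 4$ is even and $\delta=-1$; - $1$ if $n\ge 3$ is odd. Moreover, if $n$ is even, with $n\ge 4$ if $\delta=1$ and $n\ge 6$ if $\delta=-1$, then the set of matrices in $\mathcal N$ with at least one double nonreal eigenvalue has codimension $3$ in $\mathcal N$; and if $n\ge 3$ is odd, then the set of matrices in $\mathcal N$ with at least one double eigenvalue different from $-\delta$ has codimension $3$ in $\mathcal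 N$. -/

import Mathlib

open scoped ContDiff Matrix.Norms.Operator

/-- `M` is a smooth embedded submanifold of dimension `d` of the real normed space `E`: around each
of its points there is a smooth slice chart, i.e. a smooth diffeomorphism `φ` between open subsets
of `E` that carries `M` to a `d`-dimensional linear subspace. -/
def IsSmoothSubmanifold {E : Type*} [NormedAddCommGroup E] [NormedSpace ℝ E]
    (M : Set E) (d : ℕ) : Prop :=
  ∀ x ∈ M, ∃ (φ : OpenPartialHomeomorph E E) (V : Submodule ℝ E),
    x ∈ φ.source ∧
    ContDiffOn ℝ ∞ φ φ.source ∧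
    ContDiffOn ℝ ∞ φ.symm φ.target ∧
    Module.finrank ℝ V = d ∧
    ∀ y ∈ φ.source, y ∈ M ↔ φ y ∈ V

/-- The set `S` has codimension `c` in the smooth manifold `N` (both inside the normed space `E`):
`N` is a smooth submanifold of some dimension `D`, and `S ⊆ N` is a finite disjoint union of smooth
submanifolds, each of dimension at most `D - c`, and at least one of them nonempty of dimension
exactly `D - c`. When `S` is itself a nonempty smooth submanifold of dimension `d`, this says
`D - d = c`; in general it is the codimension of the top-dimensional strata. -/
def HasCodimIn {E : Type*} [NormedAddCommGroup E] [NormedSpace ℝ E]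
    (S N : Set E) (c : ℕ) : Prop :=
  S ⊆ N ∧ ∃ D : ℕ, IsSmoothSubmanifold N D ∧
    ∃ (ι : Type) (_ : Finite ι) (M : ι → Set E) (d : ι → ℕ),
      S = ⋃ i, M i ∧
      Pairwise (fun i j => Disjoint (M i) (M j)) ∧
      (∀ i, IsSmoothSubmanifold (M i) (d i)) ∧
      (∀ i, d i + c ≤ D) ∧
      ∃ i, (M i).Nonempty ∧ d i + c = D

/-- The real orthogonal `n × n` matrices of determinant `δ`. -/
def orthogonalWithDet (n : ℕ) (δ : ℝ) : Set (Matrix (Fin n) (Fin n) ℝ) :=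
  {X | X ∈ Matrix.orthogonalGroup (Fin n) ℝ ∧ X.det = δ}

/-- `X` is derogatory: some complex eigenvalue has geometric multiplicity greater than `1`. -/
def IsDerogatory {n : ℕ} (X : Matrix (Fin n) (Fin n) ℝ) : Prop :=
  ∃ z : ℂ, 1 < Module.finrank ℂ
    (Module.End.eigenspace (Matrix.toLin' (X.map (algebraMap ℝ ℂ))) z)

/-- The complex number `z` is a (at least) double eigenvalue of the real matrix `X`, i.e. a root of
multiplicity at least `2` of its characteristic polynomial. -/
def IsDoubleEigenvalue {n : ℕ} (X : Matrix (Fin n) (Fin n) ℝ) (z : ℂ) : Prop :=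
  2 ≤ (X.map (algebraMap ℝ ℂ)).charpoly.rootMultiplicity z

/-!
Let `C` be the space of skew-symmetric matrices commuting with `X` and `A ⊆ C` its subspace of
skew-symmetric elements of `ℝ[X]`. On orthogonal matrices, both `dim ℝ[X]` and `c = dim C - dim A`
take finitely many values, which stratify each of the sets in question. Near a point `X` of a
stratum every element is conjugate, by an orthogonal matrix, to one that generates the same algebra
as `X`; hence the stratum is a submanifold of codimension `c` among the orthogonal matrices.

An orthogonal `X` is normal, so `c` can be read off its eigenspaces: `p.choose 2 ≤ c` for a real
eigenvalue of multiplicity `p` and `m ^ 2 - 1 ≤ c` for a conjugate pair of nonreal eigenvalues of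
multiplicity `m`, with equality when all other eigenvalues are simple. So a double eigenvalue forces
`1 ≤ c`, and `3 ≤ c` if it is nonreal. The determinants of `X` and `-X` fix the parities of the
multiplicities of `-1` and `1`; where that parity is odd, a double eigenvalue is at least triple and
forces `3 ≤ c` as well. Direct sums of `1`, `-1` and plane rotations attain these bounds.
-/

open Filter Topology Module.End

section Submanifold

variable {E : Type*} [NormedAddCommGroup E] [NormedSpace ℝ E]

/-- `Ψ` parametrizes the set `M` near `Ψ 0` by the linear subspace `V`: it is analytic at `0` with
invertible derivative there, and near `0` it carries `V`, and nothing else, into `M`. Analyticity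
is required because, unlike being `C^∞` at a point, it persists on a neighbourhood. -/
structure IsSliceParametrization (Ψ : E → E) (M : Set E) (V : Submodule ℝ E) : Prop where
  contDiffAt : ContDiffAt ℝ ω Ψ 0
  hasFDerivAt : ∃ L : E ≃L[ℝ] E, HasFDerivAt Ψ (L : E →L[ℝ] E) 0
  mem_iff : ∀ᶠ Y in 𝓝 0, Ψ Y ∈ M ↔ Y ∈ V

theorem IsSliceParametrization.exists_chart [CompleteSpace E] {Ψ : E → E} {M : Set E}
    {V : Submodule ℝ E} (h : IsSliceParametrization Ψ M V) :
    ∃ φ : OpenPartialHomeomorph E E, Ψ 0 ∈ φ.source ∧ ContDiffOn ℝ ∞ φ φ.source ∧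
      ContDiffOn ℝ ∞ φ.symm φ.target ∧ ∀ y ∈ φ.source, y ∈ M ↔ φ y ∈ V := by
  obtain ⟨hΨ, ⟨L, hL⟩, hV⟩ := h
  have hω : (ω : WithTop ℕ∞) ≠ 0 := by simp
  have hω' : (ω : WithTop ℕ∞) ≠ ∞ := by simp
  set e := hΨ.toOpenPartialHomeomorph Ψ hL hω
  have he : (0 : E) ∈ e.source := hΨ.mem_toOpenPartialHomeomorph_source hL hω
  have hinv : ContDiffAt ℝ ω e.symm (Ψ 0) := hΨ.to_localInverse hL hω
  obtain ⟨U, hU, hUo, hU0⟩ := eventually_nhds_iff.1 (hV.and (hΨ.eventually hω'))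
  obtain ⟨W, hW, hWo, hW0⟩ := eventually_nhds_iff.1 (hinv.eventually hω')
  set e' := e.restrOpen U hUo
  refine ⟨e'.symm.restrOpen W hWo, ⟨e'.map_source ⟨he, hU0⟩, hW0⟩,
    fun y hy => ((hW y hy.2).of_le (by simp)).contDiffWithinAt,
    fun y hy => ((hU y hy.1.2).2.of_le (by simp)).contDiffWithinAt, fun y hy => ?_⟩
  have hΨy : Ψ (e'.symm y) = y := e'.right_inv hy.1
  have hmem := (hU _ (e'.map_target hy.1).2).1
  rwa [hΨy] at hmem

theorem isSmoothSubmanifold_of_isSliceParametrization [CompleteSpace E] {M : Set E} {d : ℕ}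
    (h : ∀ x ∈ M, ∃ (Ψ : E → E) (V : Submodule ℝ E),
      Ψ 0 = x ∧ IsSliceParametrization Ψ M V ∧ Module.finrank ℝ V = d) :
    IsSmoothSubmanifold M d := by
  intro x hx
  obtain ⟨Ψ, V, rfl, hΨ, hd⟩ := h x hx
  obtain ⟨φ, hsource, hφ, hφsymm, hmem⟩ := hΨ.exists_chart
  exact ⟨φ, V, hsource, hφ, hφsymm, hd, hmem⟩

end Submanifold

section Normal

variable {ι : Type*} [Fintype ι] {𝕜 : Type*} [RCLike 𝕜]

open Matrix
open scoped ComplexOrder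

theorem mulVec_eq_zero_of_mulVec_mulVec_eq_zero {N : Matrix ι ι 𝕜} [hN : IsStarNormal N]
    {v : ι → 𝕜} (hv : N *ᵥ N *ᵥ v = 0) : N *ᵥ v = 0 := by
  have h : (N * Nᴴ) *ᵥ N *ᵥ v = 0 := by
    rw [← star_eq_conjTranspose, ← hN.star_comm_self.eq, ← mulVec_mulVec, hv, mulVec_zero]
  rwa [self_mul_conjTranspose_mulVec_eq_zero, mulVec_mulVec,
    conjTranspose_mul_self_mulVec_eq_zero] at h

variable [DecidableEq ι]

theorem isStarNormal_sub_smul_one (A : Matrix ι ι 𝕜) [hA : IsStarNormal A] (z : 𝕜) :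
    IsStarNormal (A - z • 1) where
  star_comm_self := by
    simp only [star_sub, star_smul, star_one]
    refine Commute.sub_left (hA.star_comm_self.sub_right ?_) (Commute.sub_right ?_ ?_)
    · exact (Commute.one_right _).smul_right z
    · exact (Commute.one_left _).smul_left _
    · exact ((Commute.one_left _).smul_left _).smul_right _

theorem maxGenEigenspace_toLin'_eq_eigenspace (A : Matrix ι ι 𝕜) [IsStarNormal A] (z : 𝕜) :
    maxGenEigenspace (toLin' A) z = eigenspace (toLin' A) z := by
  have := isStarNormal_sub_smul_one A z
  have hlin : toLin' A - z • (1 : Module.End 𝕜 (ι → 𝕜)) = toLin' (A - z • 1) := by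
    rw [map_sub, map_smul, toLin'_one]; rfl
  have hker : LinearMap.ker (toLin' (A - z • 1) ^ 1) = LinearMap.ker (toLin' (A - z • 1) ^ 2) := by
    refine le_antisymm (LinearMap.ker_le_ker_comp _ _) fun v hv => ?_
    rw [LinearMap.mem_ker, pow_two, Module.End.mul_apply, toLin'_apply, toLin'_apply] at hv
    rw [LinearMap.mem_ker, pow_one, toLin'_apply, mulVec_eq_zero_of_mulVec_mulVec_eq_zero hv]
  refine le_antisymm (fun v hv => ?_) ((genEigenspace _ z).mono le_top)
  obtain ⟨k, hk⟩ := (mem_maxGenEigenspace _ _ _).1 hv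
  have hv' : v ∈ LinearMap.ker (toLin' (A - z • 1) ^ (1 + k)) := by
    rw [LinearMap.mem_ker, pow_add, ← hlin, Module.End.mul_apply, hk, map_zero]
  rw [← ker_pow_constant hker, pow_one, ← hlin] at hv'
  rwa [eigenspace_def]

theorem finrank_eigenspace_toLin' (A : Matrix ι ι 𝕜) [IsStarNormal A] (z : 𝕜) :
    Module.finrank 𝕜 (eigenspace (toLin' A) z) = A.charpoly.rootMultiplicity z := by
  rw [← maxGenEigenspace_toLin'_eq_eigenspace, LinearMap.finrank_maxGenEigenspace_eq,
    charpoly_toLin']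

end Normal

section JointEigenvalue

variable {ι : Type*} [Fintype ι] {𝕜 : Type*}

open Matrix
open scoped ComplexOrder

theorem norm_eq_one_of_mulVec_eq_smul [RCLike 𝕜] [DecidableEq ι] {U : Matrix ι ι 𝕜}
    (hU : U ∈ unitaryGroup ι 𝕜) {v : ι → 𝕜} (hv : v ≠ 0) {z : 𝕜} (hz : U *ᵥ v = z • v) :
    ‖z‖ = 1 := by
  have hnorm : star (U *ᵥ v) ⬝ᵥ (U *ᵥ v) = star v ⬝ᵥ v := by
    rw [star_mulVec, ← dotProduct_mulVec, mulVec_mulVec, ← star_eq_conjTranspose,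
      Unitary.star_mul_self_of_mem hU, one_mulVec]
  have hv' : star v ⬝ᵥ v ≠ 0 := dotProduct_star_self_eq_zero.not.2 hv
  rw [hz, star_smul, smul_dotProduct, dotProduct_smul, smul_smul, smul_eq_mul] at hnorm
  have hsq : ((‖z‖ ^ 2 : ℝ) : 𝕜) = 1 := by
    rw [RCLike.ofReal_pow, ← RCLike.conj_mul]
    exact mul_right_cancel₀ hv' (hnorm.trans (one_mul _).symm)
  exact (pow_eq_one_iff_of_nonneg (norm_nonneg z) two_ne_zero).1 (by exact_mod_cast hsq)

/-- The pair `(z, w)` is a joint eigenvalue of the matrices `A` and `B`: they have a common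
eigenvector, with eigenvalue `z` for `A` and `w` for `B`. -/
def IsJointEigenvalue [Semiring 𝕜] (A B : Matrix ι ι 𝕜) (z w : 𝕜) : Prop :=
  ∃ v ≠ 0, A *ᵥ v = z • v ∧ B *ᵥ v = w • v

theorem IsJointEigenvalue.norm_sub_le [NormedField 𝕜] {A B : Matrix ι ι 𝕜} {z w : 𝕜}
    (h : IsJointEigenvalue A B z w) : ‖z - w‖ ≤ ‖A - B‖ := by
  obtain ⟨v, hv, hz, hw⟩ := h
  have hbound := linfty_opNorm_mulVec (A - B) v
  rw [sub_mulVec, hz, hw, ← sub_smul, norm_smul] at hbound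
  exact le_of_mul_le_mul_right hbound (norm_pos_iff.2 hv)

variable [DecidableEq ι] [Field 𝕜]

theorem hasEigenvalue_toLin'_of_mulVec_eq_smul {A : Matrix ι ι 𝕜} {v : ι → 𝕜} (hv : v ≠ 0) {z : 𝕜}
    (hz : A *ᵥ v = z • v) : HasEigenvalue (toLin' A) z :=
  hasEigenvalue_of_hasEigenvector ⟨mem_eigenspace_iff.2 hz, hv⟩

theorem aeval_mulVec_of_mulVec_eq_smul {A : Matrix ι ι 𝕜} {v : ι → 𝕜} {z : 𝕜}
    (hz : A *ᵥ v = z • v) (p : Polynomial 𝕜) : Polynomial.aeval A p *ᵥ v = p.eval z • v := by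
  have hp : toLinAlgEquiv' (Polynomial.aeval A p) = Polynomial.aeval (toLinAlgEquiv' A) p :=
    (Polynomial.aeval_algHom_apply (toLinAlgEquiv' : Matrix ι ι 𝕜 ≃ₐ[𝕜] _).toAlgHom A p).symm
  rw [← toLinAlgEquiv'_apply, hp]
  exact aeval_apply_of_mem_apply_eq_smul hz

theorem iSup_eigenspace_inf_eigenspace_toLin'_eq_top {A B : Matrix ι ι ℂ} [IsStarNormal A]
    [IsStarNormal B] (hAB : Commute A B) :
    ⨆ χ : Bool → ℂ, eigenspace (toLin' A) (χ true) ⊓ eigenspace (toLin' B) (χ false) = ⊤ := by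
  have htop := iSup_iInf_maxGenEigenspace_eq_top_of_iSup_maxGenEigenspace_eq_top_of_commute
    (fun b : Bool => toLin' (cond b A B)) ?_ fun b => iSup_maxGenEigenspace_eq_top _
  · simpa only [iInf_bool_eq, cond_true, cond_false, maxGenEigenspace_toLin'_eq_eigenspace]
      using htop
  · have hcomm := hAB.map (toLinAlgEquiv' : Matrix ι ι ℂ ≃ₐ[ℂ] _)
    rintro (_ | _) (_ | _) hne
    exacts [absurd rfl hne, hcomm.symm, hcomm, absurd rfl hne]

theorem mem_adjoin_singleton_of_isJointEigenvalue {A B : Matrix ι ι ℂ} [IsStarNormal A]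
    [IsStarNormal B] (hAB : Commute A B)
    (hunique : ∀ {z z' w}, IsJointEigenvalue A B z w → IsJointEigenvalue A B z' w → z = z') :
    A ∈ Algebra.adjoin ℂ {B} := by
  have hg (w : ℂ) : ∃ z₀, ∀ z, IsJointEigenvalue A B z w → z = z₀ := by
    by_cases h : ∃ z, IsJointEigenvalue A B z w
    · exact ⟨h.choose, fun z hz => hunique hz h.choose_spec⟩
    · exact ⟨0, fun z hz => absurd ⟨z, hz⟩ h⟩
  choose g hg using hg
  rw [Algebra.adjoin_singleton_eq_range_aeval]
  set p := Lagrange.interpolate (finite_hasEigenvalue (toLin' B)).toFinset id g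
  refine ⟨p, mulVec_injective (funext fun v => ?_)⟩
  refine Submodule.iSup_induction _ (motive := fun v => Polynomial.aeval B p *ᵥ v = A *ᵥ v)
    ((iSup_eigenspace_inf_eigenspace_toLin'_eq_top hAB).ge trivial) (fun χ v hv => ?_) (by simp)
    fun v w hv hw => by rw [mulVec_add, mulVec_add, hv, hw]
  rcases eq_or_ne v 0 with rfl | hv0
  · simp
  have hA : A *ᵥ v = χ true • v := mem_eigenspace_iff.1 hv.1
  have hB : B *ᵥ v = χ false • v := mem_eigenspace_iff.1 hv.2
  have heval : p.eval (χ false) = g (χ false) :=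
    Lagrange.eval_interpolate_at_node g (Set.injOn_id _)
      ((Set.Finite.mem_toFinset _).2 (hasEigenvalue_toLin'_of_mulVec_eq_smul hv0 hB))
  rw [aeval_mulVec_of_mulVec_eq_smul hB, hA, heval, hg _ _ ⟨v, hv0, hA, hB⟩]

end JointEigenvalue

section Complexification

variable {ι : Type*} [Fintype ι] [DecidableEq ι]

open Matrix

/-- The complexification of real square matrices, as a homomorphism of real star algebras. -/
noncomputable def complexify : Matrix ι ι ℝ →⋆ₐ[ℝ] Matrix ι ι ℂ where
  __ := (Algebra.ofId ℝ ℂ).mapMatrix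
  map_star' X := by ext i j; simp

theorem complexify_apply (X : Matrix ι ι ℝ) : complexify X = X.map (algebraMap ℝ ℂ) := rfl

theorem norm_complexify (X : Matrix ι ι ℝ) : ‖complexify X‖ = ‖X‖ := by
  simp [linfty_opNorm_def, complexify_apply]

theorem mem_adjoin_of_complexify_mem_adjoin {X Y : Matrix ι ι ℝ}
    (h : complexify Y ∈ Algebra.adjoin ℂ {complexify X}) : Y ∈ Algebra.adjoin ℝ {X} := by
  rw [Algebra.adjoin_singleton_eq_range_aeval] at h
  obtain ⟨p, hp : Polynomial.aeval (complexify X) p = complexify Y⟩ := h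
  have hY : Y = ∑ i ∈ Finset.range (p.natDegree + 1), (p.coeff i).re • X ^ i := by
    ext a b
    have hre := congrArg (fun M : Matrix ι ι ℂ => (M a b).re) hp
    simp only [Polynomial.aeval_eq_sum_range, ← map_pow] at hre
    simp only [Matrix.sum_apply, Matrix.smul_apply, Complex.re_sum, complexify_apply,
      map_apply, Complex.coe_algebraMap, smul_eq_mul,
      Complex.re_mul_ofReal, Complex.ofReal_re] at hre
    rw [← hre, Matrix.sum_apply]
    rfl
  rw [hY]
  exact Subalgebra.sum_mem _ fun i _ => Subalgebra.smul_mem _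
    (pow_mem (Algebra.self_mem_adjoin_singleton ℝ X) i) _

theorem exists_forall_dist_lt_imp_eq_of_finite {α : Type*} [MetricSpace α] {s : Set α}
    (hs : s.Finite) : ∃ ε > 0, ∀ z ∈ s, ∀ w ∈ s, dist z w < ε → z = w := by
  rcases s.subsingleton_or_nontrivial with h | h
  · exact ⟨1, one_pos, fun z hz w hw _ => h hz hw⟩
  · refine ⟨s.infsep, hs.infsep_pos_iff_nontrivial.2 h, fun z hz w hw hzw => ?_⟩
    by_contra hne
    exact (Set.infsep_le_dist_of_mem hz hw hne).not_gt hzw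

theorem eventually_mem_adjoin_singleton_of_commute {X : Matrix ι ι ℝ}
    (hX : X ∈ orthogonalGroup ι ℝ) :
    ∀ᶠ Y in 𝓝 X, Y ∈ orthogonalGroup ι ℝ → Commute X Y → X ∈ Algebra.adjoin ℝ {Y} := by
  obtain ⟨ε, hε, hsep⟩ :=
    exists_forall_dist_lt_imp_eq_of_finite (finite_hasEigenvalue (toLin' (complexify X)))
  filter_upwards [Metric.ball_mem_nhds X (half_pos hε)] with Y hYX hY hXY
  rw [Metric.mem_ball', dist_eq_norm, ← norm_complexify, map_sub] at hYX
  have hnX := isStarNormal_of_mem_unitary (Unitary.map_mem complexify hX)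
  have hnY := isStarNormal_of_mem_unitary (Unitary.map_mem complexify hY)
  refine mem_adjoin_of_complexify_mem_adjoin <|
    mem_adjoin_singleton_of_isJointEigenvalue (hXY.map complexify) fun {z z' w} hz hz' => ?_
  have hzw := dist_eq_norm z w ▸ hz.norm_sub_le.trans_lt hYX
  have hzw' := dist_eq_norm z' w ▸ hz'.norm_sub_le.trans_lt hYX
  obtain ⟨⟨v, hv, hA, -⟩, ⟨v', hv', hA', -⟩⟩ := And.intro hz hz'
  refine hsep _ (hasEigenvalue_toLin'_of_mulVec_eq_smul hv hA) _
    (hasEigenvalue_toLin'_of_mulVec_eq_smul hv' hA') ?_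
  linarith [dist_triangle_right z z' w]

end Complexification

section Cayley

variable {A : Type*} [Ring A]

/-- The Cayley transform `(1 - b)⁻¹ (1 + b)`, which carries skew-adjoint elements of a star ring to
unitary ones. It is only meaningful when `1 - b` is a unit. -/
noncomputable def cayley (b : A) : A := Ring.inverse (1 - b) * (1 + b)

theorem cayley_zero : cayley (0 : A) = 1 := by
  simp [cayley]

theorem one_sub_mul_cayley {b : A} (hb : IsUnit (1 - b)) : (1 - b) * cayley b = 1 + b :=
  Ring.mul_inverse_cancel_left _ _ hb

theorem cayley_mul_one_sub {b : A} (hb : IsUnit (1 - b)) : cayley b * (1 - b) = 1 + b := by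
  have hcomm : (1 + b) * (1 - b) = (1 - b) * (1 + b) := by noncomm_ring
  rw [cayley, mul_assoc, hcomm, Ring.inverse_mul_cancel_left _ _ hb]

theorem one_sub_mul_cayley_add_one {b : A} (hb : IsUnit (1 - b)) :
    (1 - b) * (cayley b + 1) = 2 := by
  rw [mul_add, one_sub_mul_cayley hb, mul_one, add_add_sub_cancel, one_add_one_eq_two]

theorem star_cayley [StarRing A] {b : A} (hb : b ∈ skewAdjoint A) (hu : IsUnit (1 - b)) :
    star (cayley b) = cayley (-b) := by
  have hstar : star (1 - b) = 1 + b := by rw [star_sub, star_one, hb, sub_neg_eq_add]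
  have hu' : IsUnit (1 - -b) := by rw [sub_neg_eq_add, ← hstar]; exact hu.star
  refine hu'.mul_right_cancel ?_
  rw [cayley_mul_one_sub hu', sub_neg_eq_add, ← hstar, ← star_mul, one_sub_mul_cayley hu, star_add,
    star_one, hb]

theorem cayley_mem_unitary [StarRing A] {b : A} (hb : b ∈ skewAdjoint A) (hu : IsUnit (1 - b)) :
    cayley b ∈ unitary A := by
  have hstar : star (1 - b) = 1 - -b := by rw [star_sub, star_one, hb]
  have hu' : IsUnit (1 - -b) := hstar ▸ hu.star
  rw [Unitary.mem_iff, star_cayley hb hu]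
  constructor
  · refine hu.mul_right_cancel ?_
    rw [mul_assoc, cayley_mul_one_sub hu, ← sub_neg_eq_add, cayley_mul_one_sub hu', one_mul,
      ← sub_eq_add_neg]
  · refine hu'.mul_right_cancel ?_
    rw [mul_assoc, cayley_mul_one_sub hu', ← sub_eq_add_neg, cayley_mul_one_sub hu, one_mul,
      sub_neg_eq_add]

theorem commute_cayley {x b : A} (h : Commute x b) : Commute x (cayley b) := by
  refine Commute.mul_right ?_ ((Commute.one_right x).add_right h)
  by_cases hu : IsUnit (1 - b)
  · obtain ⟨u, hu⟩ := hu
    have hxu : Commute x u := hu ▸ (Commute.one_right x).sub_right h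
    rw [← hu, Ring.inverse_unit]
    exact hxu.units_inv_right
  · rw [Ring.inverse_non_unit _ hu]
    exact Commute.zero_right x

section Subalgebra

variable [Algebra ℝ A] [FiniteDimensional ℝ A] {S : Subalgebra ℝ A}

theorem inverse_mem_subalgebra {x : A} (hx : x ∈ S) : Ring.inverse x ∈ S := by
  by_cases hu : IsUnit x
  · have hreg : (⟨x, hx⟩ : S) ∈ nonZeroDivisors S :=
      comap_nonZeroDivisors_le_of_injective (f := S.subtype) Subtype.val_injective
        hu.mem_nonZeroDivisors
    obtain ⟨u, hu'⟩ := IsArtinianRing.isUnit_of_nonZeroDivisor_of_isIntegral' (R := ℝ) hreg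
    have hx' : x = Units.map S.val.toMonoidHom u := (congrArg Subtype.val hu').symm
    rw [hx', Ring.inverse_unit, ← map_inv]
    exact (u⁻¹ : Sˣ).val.2
  · rw [Ring.inverse_non_unit _ hu]
    exact S.zero_mem

theorem cayley_mem_subalgebra {b : A} (hb : b ∈ S) : cayley b ∈ S :=
  S.mul_mem (inverse_mem_subalgebra (S.sub_mem S.one_mem hb)) (S.add_mem S.one_mem hb)

theorem mem_subalgebra_of_cayley_mem {b : A} (hu : IsUnit (1 - b)) (h : cayley b ∈ S) : b ∈ S := by
  have hhalf : (1 - b) * ((2 : ℝ)⁻¹ • (cayley b + 1)) = 1 := by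
    rw [mul_smul_comm, one_sub_mul_cayley_add_one hu, ← one_add_one_eq_two (R := A),
      ← two_smul ℝ (1 : A), inv_smul_smul₀ two_ne_zero]
  have hinv : Ring.inverse (1 - b) ∈ S := by
    rw [← mul_one (Ring.inverse (1 - b)),
      (Ring.inverse_mul_eq_iff_eq_mul _ _ _ hu).2 hhalf.symm]
    exact S.smul_mem (S.add_mem h S.one_mem) _
  obtain ⟨u, hu⟩ := hu
  have hmem := inverse_mem_subalgebra hinv
  rw [← hu, Ring.inverse_unit, Ring.inverse_unit, inv_inv, hu] at hmem
  simpa only [sub_sub_cancel] using S.sub_mem S.one_mem hmem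

end Subalgebra

end Cayley

section CayleyAnalytic

variable {A : Type*} [NormedRing A] [NormedAlgebra ℝ A] [HasSummableGeomSeries A]

theorem contDiffAt_cayley : ContDiffAt ℝ ω (cayley : A → A) 0 := by
  have hinv : ContDiffAt ℝ ω (Ring.inverse : A → A) (1 - 0) := by
    simpa using contDiffAt_ringInverse ℝ (1 : Aˣ)
  exact (hinv.comp (0 : A) (contDiffAt_const.sub contDiffAt_id)).mul
    (contDiffAt_const.add contDiffAt_id)

theorem hasFDerivAt_cayley :
    HasFDerivAt (cayley : A → A) ((2 : ℝ) • ContinuousLinearMap.id ℝ A) 0 := by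
  have hinv : HasFDerivAt (Ring.inverse : A → A) (-ContinuousLinearMap.id ℝ A) (1 - 0) := by
    convert hasFDerivAt_ringInverse (𝕜 := ℝ) (1 : Aˣ) using 1
    · ext; simp
    · simp
  have hsub := (hasFDerivAt_id (𝕜 := ℝ) (0 : A)).const_sub 1
  have hadd := (hasFDerivAt_id (𝕜 := ℝ) (0 : A)).const_add 1
  refine ((hinv.comp 0 hsub).mul' hadd).congr_fderiv ?_
  ext y
  simp [two_smul]

end CayleyAnalytic

section MatrixCayley

variable {ι : Type*} [Fintype ι] [DecidableEq ι] {𝕜 : Type*} [RCLike 𝕜]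

open Matrix
open scoped ComplexOrder

theorem isUnit_one_sub_of_mem_skewAdjoint {B : Matrix ι ι 𝕜} (hB : B ∈ skewAdjoint (Matrix ι ι 𝕜)) :
    IsUnit (1 - B) := by
  rw [isUnit_iff_isUnit_det, isUnit_iff_ne_zero]
  intro hdet
  obtain ⟨v, hv, hker⟩ := exists_mulVec_eq_zero_iff.2 hdet
  have hfix : B *ᵥ v = v := by
    rw [sub_mulVec, one_mulVec, sub_eq_zero] at hker
    exact hker.symm
  have hneg : star v ⬝ᵥ v = -(star v ⬝ᵥ v) := by
    conv_lhs => rw [← hfix, star_mulVec, ← star_eq_conjTranspose, skewAdjoint.mem_iff.1 hB,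
      vecMul_neg, neg_dotProduct, ← dotProduct_mulVec]
    rw [hfix, hfix]
  exact hv (dotProduct_star_self_eq_zero.1 (self_eq_neg.1 hneg))

theorem cayley_mem_unitaryGroup {B : Matrix ι ι 𝕜} (hB : B ∈ skewAdjoint (Matrix ι ι 𝕜)) :
    cayley B ∈ unitaryGroup ι 𝕜 :=
  cayley_mem_unitary hB (isUnit_one_sub_of_mem_skewAdjoint hB)

end MatrixCayley

section SkewSubspaces

variable {A : Type*} [Ring A] [StarRing A] [Algebra ℝ A] [StarModule ℝ A]

/-- The skew-adjoint elements that commute with `x`: for unitary `x`, the Lie algebra of the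
stabilizer of `x` under conjugation by unitary elements. -/
def skewCentralizer (x : A) : Submodule ℝ A :=
  skewAdjoint.submodule ℝ A ⊓ (Subalgebra.centralizer ℝ {x}).toSubmodule

/-- The skew-adjoint elements of the algebra generated by `x`. -/
def skewAdjoin (x : A) : Submodule ℝ A :=
  skewAdjoint.submodule ℝ A ⊓ (Algebra.adjoin ℝ {x}).toSubmodule

/-- The codimension of `skewAdjoin x` in `skewCentralizer x`. It will be the codimension, in the
unitary group, of the set of unitary elements near `x` whose stabilizer is conjugate to that
of `x`. -/
noncomputable def skewCodim (x : A) : ℕ :=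
  Module.finrank ℝ (skewCentralizer x) - Module.finrank ℝ (skewAdjoin x)

theorem mem_skewCentralizer {x y : A} :
    y ∈ skewCentralizer x ↔ y ∈ skewAdjoint A ∧ Commute x y := by
  rw [skewCentralizer, Submodule.mem_inf, Subalgebra.mem_toSubmodule,
    Subalgebra.mem_centralizer_iff]
  simp only [Set.mem_singleton_iff, forall_eq]
  rfl

theorem mem_skewAdjoin {x y : A} :
    y ∈ skewAdjoin x ↔ y ∈ skewAdjoint A ∧ y ∈ Algebra.adjoin ℝ {x} := Iff.rfl

theorem skewAdjoin_le_skewCentralizer (x : A) : skewAdjoin x ≤ skewCentralizer x :=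
  fun _ hy => mem_skewCentralizer.2 ⟨hy.1, Algebra.commute_of_mem_adjoin_self hy.2⟩

theorem skewCodim_add_finrank_skewAdjoin [FiniteDimensional ℝ A] (x : A) :
    skewCodim x + Module.finrank ℝ (skewAdjoin x) = Module.finrank ℝ (skewCentralizer x) :=
  Nat.sub_add_cancel (Submodule.finrank_mono (skewAdjoin_le_skewCentralizer x))

theorem skewCentralizer_le_of_mem_adjoin {x y : A} (h : x ∈ Algebra.adjoin ℝ {y}) :
    skewCentralizer y ≤ skewCentralizer x := fun b hb => by
  rw [mem_skewCentralizer] at hb ⊢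
  exact ⟨hb.1, (Algebra.commute_of_mem_adjoin_singleton_of_commute h hb.2.symm).symm⟩

theorem skewCodim_eq_of_adjoin_eq {x y : A} (h : Algebra.adjoin ℝ {x} = Algebra.adjoin ℝ {y}) :
    skewCodim x = skewCodim y := by
  have hC : skewCentralizer x = skewCentralizer y := le_antisymm
    (skewCentralizer_le_of_mem_adjoin (h ▸ Algebra.self_mem_adjoin_singleton ℝ y))
    (skewCentralizer_le_of_mem_adjoin (h ▸ Algebra.self_mem_adjoin_singleton ℝ x))
  rw [skewCodim, skewCodim, hC, skewAdjoin, skewAdjoin, h]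

end SkewSubspaces

section Transport

variable {A B : Type*} [Ring A] [StarRing A] [Algebra ℝ A] [Ring B] [StarRing B] [Algebra ℝ B]
  (Φ : A ≃⋆ₐ[ℝ] B) (x : A)

theorem map_mem_skewAdjoint_iff {y : A} : Φ y ∈ skewAdjoint B ↔ y ∈ skewAdjoint A := by
  rw [skewAdjoint.mem_iff, skewAdjoint.mem_iff, ← map_star, ← map_neg,
    EmbeddingLike.apply_eq_iff_eq]

theorem adjoin_singleton_map :
    Algebra.adjoin ℝ {Φ x} = (Algebra.adjoin ℝ {x}).map Φ.toAlgEquiv.toAlgHom := by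
  rw [AlgHom.map_adjoin_singleton]
  rfl

theorem finrank_adjoin_singleton_map :
    Module.finrank ℝ (Algebra.adjoin ℝ {Φ x}) = Module.finrank ℝ (Algebra.adjoin ℝ {x}) := by
  rw [adjoin_singleton_map]
  exact (Φ.toAlgEquiv.subalgebraMap _).toLinearEquiv.finrank_eq.symm

variable [StarModule ℝ A] [StarModule ℝ B]

theorem comap_skewCentralizer_map :
    (skewCentralizer (Φ x)).comap Φ.toAlgEquiv.toLinearMap = skewCentralizer x := by
  ext y
  change Φ y ∈ skewCentralizer (Φ x) ↔ _
  rw [mem_skewCentralizer, mem_skewCentralizer, map_mem_skewAdjoint_iff]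
  exact and_congr_right' (commute_map_iff Φ.injective)

theorem comap_skewAdjoin_map :
    (skewAdjoin (Φ x)).comap Φ.toAlgEquiv.toLinearMap = skewAdjoin x := by
  ext y
  change Φ y ∈ skewAdjoin (Φ x) ↔ _
  rw [mem_skewAdjoin, mem_skewAdjoin, map_mem_skewAdjoint_iff, adjoin_singleton_map]
  exact and_congr_right' Φ.injective.mem_set_image

theorem skewCodim_map : skewCodim (Φ x) = skewCodim x := by
  have hfinrank (V : Submodule ℝ B) :
      Module.finrank ℝ V = Module.finrank ℝ (V.comap Φ.toAlgEquiv.toLinearMap) :=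
    (Φ.toAlgEquiv.toLinearEquiv.ofSubmodule' V).finrank_eq.symm
  rw [skewCodim, skewCodim, hfinrank, hfinrank, comap_skewCentralizer_map, comap_skewAdjoin_map]

end Transport

section SliceParam

variable {A : Type*} [NormedRing A] [NormedAlgebra ℝ A]

/-- A parametrization of a normed algebra near `x` adapted to conjugation by unitary elements. The
component `s` leaves the unitary group, `b` moves `x` within its centralizer, and `a` conjugates. -/
noncomputable def sliceParam (x : A) (a b s : A →L[ℝ] A) (y : A) : A :=
  cayley (a y) * (x * cayley (b y)) * (1 + s y) * cayley (-(a y))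

variable (x : A) (a b s : A →L[ℝ] A)

theorem sliceParam_zero : sliceParam x a b s 0 = x := by
  simp [sliceParam, cayley_zero]

variable [HasSummableGeomSeries A]

theorem contDiffAt_cayley_comp (f : A →L[ℝ] A) : ContDiffAt ℝ ω (fun y => cayley (f y)) 0 :=
  ContDiffAt.comp 0 (by rw [map_zero]; exact contDiffAt_cayley) f.contDiff.contDiffAt

theorem hasFDerivAt_cayley_comp (f : A →L[ℝ] A) :
    HasFDerivAt (fun y => cayley (f y)) ((2 : ℝ) • f) 0 := by
  have hcayley : HasFDerivAt (cayley : A → A) ((2 : ℝ) • ContinuousLinearMap.id ℝ A) (f 0) := by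
    rw [map_zero]
    exact hasFDerivAt_cayley
  exact (hcayley.comp 0 f.hasFDerivAt).congr_fderiv (by ext; simp)

theorem contDiffAt_sliceParam : ContDiffAt ℝ ω (sliceParam x a b s) 0 :=
  (((contDiffAt_cayley_comp a).mul (contDiffAt_const.mul (contDiffAt_cayley_comp b))).mul
    (contDiffAt_const.add s.contDiff.contDiffAt)).mul (contDiffAt_cayley_comp (-a))

theorem hasFDerivAt_sliceParam :
    HasFDerivAt (sliceParam x a b s)
      ((2 : ℝ) • ((ContinuousLinearMap.mul ℝ A).flip x ∘L a + ContinuousLinearMap.mul ℝ A x ∘L b -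
        ContinuousLinearMap.mul ℝ A x ∘L a) + ContinuousLinearMap.mul ℝ A x ∘L s) 0 := by
  refine ((((hasFDerivAt_cayley_comp a).mul' ((hasFDerivAt_cayley_comp b).const_mul x)).mul'
    (s.hasFDerivAt.const_add 1)).mul' (hasFDerivAt_cayley_comp (-a))).congr_fderiv ?_
  ext y
  simp [cayley_zero, smul_sub]
  abel

end SliceParam

section SelfAdjointUnitary

variable {A : Type*} [NormedRing A] [NormedAlgebra ℝ A] [HasSummableGeomSeries A] [StarRing A]

theorem eq_zero_of_one_add_mem_unitary {s : A} (hs : IsSelfAdjoint s) (hnorm : ‖s‖ < 2)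
    (h : 1 + s ∈ unitary A) : s = 0 := by
  have hsq := Unitary.star_mul_self_of_mem h
  rw [star_add, star_one, hs.star_eq] at hsq
  have hunit : IsUnit (1 - -((2 : ℝ)⁻¹ • s)) := by
    refine isUnit_one_sub_of_norm_lt_one ?_
    rw [norm_neg, norm_smul, norm_inv, Real.norm_two]
    linarith
  have hfactor : (1 + s) * (1 + s) = 1 + (2 : ℝ) • (s * (1 - -((2 : ℝ)⁻¹ • s))) := by
    rw [sub_neg_eq_add, mul_add s, mul_smul_comm, smul_add, smul_smul, mul_inv_cancel₀ two_ne_zero,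
      one_smul, two_smul]
    noncomm_ring
  rw [hfactor, add_eq_left, smul_eq_zero] at hsq
  exact hunit.mul_left_eq_zero.1 (hsq.resolve_left two_ne_zero)

end SelfAdjointUnitary

section Projection

variable {K V : Type*} [DivisionRing K] [AddCommGroup V] [Module K V]

theorem exists_isProj (W : Submodule K V) : ∃ g : V →ₗ[K] V, LinearMap.IsProj W g := by
  obtain ⟨f, hf⟩ := W.subtype.exists_leftInverse_of_injective W.ker_subtype
  exact ⟨W.subtype ∘ₗ f, fun v => (f v).2,
    fun v hv => congrArg Subtype.val (LinearMap.congr_fun hf ⟨v, hv⟩)⟩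

variable [FiniteDimensional K V] {C S W : Submodule K V} {g : V →ₗ[K] V}

theorem finrank_inf_comap_eq_add (hg : LinearMap.IsProj C g) (hW : W ≤ C) (hC : C ≤ S) :
    Module.finrank K ↥(S ⊓ W.comap g) =
      Module.finrank K W + Module.finrank K ↥(S ⊓ LinearMap.ker g) := by
  have hinf : W ⊓ (S ⊓ LinearMap.ker g) = ⊥ :=
    (hg.isCompl.disjoint.mono hW inf_le_right).eq_bot
  have hsup : W ⊔ (S ⊓ LinearMap.ker g) = S ⊓ W.comap g := by
    refine le_antisymm (sup_le ?_ ?_) fun v hv => ?_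
    · exact le_inf (hW.trans hC) fun w hw => by rwa [Submodule.mem_comap, hg.map_id w (hW hw)]
    · exact inf_le_inf_left S (LinearMap.ker_le_comap g)
    · rw [← add_sub_cancel (g v) v]
      refine add_mem (Submodule.mem_sup_left hv.2) (Submodule.mem_sup_right ⟨?_, ?_⟩)
      · exact sub_mem hv.1 (hC (hg.map_mem v))
      · rw [SetLike.mem_coe, LinearMap.mem_ker, map_sub, hg.map_id _ (hg.map_mem v), sub_self]
  rw [← hsup, ← Submodule.finrank_sup_add_finrank_inf_eq, hinf, finrank_bot, add_zero]

theorem finrank_inf_comap_add_finrank (hg : LinearMap.IsProj C g) (hW : W ≤ C) (hC : C ≤ S) :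
    Module.finrank K ↥(S ⊓ W.comap g) + Module.finrank K C =
      Module.finrank K W + Module.finrank K S := by
  have hS : C.comap g = ⊤ := eq_top_iff.2 fun v _ => hg.map_mem v
  have hCS := finrank_inf_comap_eq_add hg le_rfl hC
  rw [hS, inf_top_eq] at hCS
  rw [hCS, finrank_inf_comap_eq_add hg hW hC]
  ring

end Projection

section SkewPart

variable (A : Type*) [AddCommGroup A] [StarAddMonoid A] [Module ℝ A] [StarModule ℝ A]

/-- The projection onto the skew-adjoint elements along the self-adjoint ones, as an endomorphism
of the whole space. -/
noncomputable def skewPart : A →ₗ[ℝ] A :=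
  (skewAdjoint.submodule ℝ A).subtype ∘ₗ skewAdjointPart ℝ

variable {A}

theorem skewPart_mem (y : A) : skewPart A y ∈ skewAdjoint A :=
  (skewAdjointPart ℝ y).2

theorem isSelfAdjoint_sub_skewPart (y : A) : IsSelfAdjoint (y - skewPart A y) := by
  have hadd : (selfAdjointPart ℝ y : A) + skewPart A y = y :=
    StarModule.selfAdjointPart_add_skewAdjointPart ℝ y
  rw [← eq_sub_of_add_eq hadd]
  exact (selfAdjointPart ℝ y).2

theorem skewPart_eq_self {y : A} (hy : y ∈ skewAdjoint A) : skewPart A y = y := by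
  refine (skewAdjointPart_apply_coe ℝ y).trans ?_
  rw [hy, sub_neg_eq_add, ← two_smul ℝ y, invOf_smul_smul]

theorem sub_skewPart_eq_zero_iff {y : A} : y - skewPart A y = 0 ↔ y ∈ skewAdjoint A := by
  rw [sub_eq_zero]
  exact ⟨fun h => h ▸ skewPart_mem y, fun h => (skewPart_eq_self h).symm⟩

end SkewPart

section SliceDerivative

variable {A : Type*} [AddCommGroup A] [StarAddMonoid A] [Module ℝ A] [StarModule ℝ A]

theorem eq_zero_of_two_smul_add_eq_zero {w s : A} (hw : w ∈ skewAdjoint A) (hs : IsSelfAdjoint s)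
    (h : (2 : ℝ) • w + s = 0) : w = 0 ∧ s = 0 := by
  have hstar := congrArg star h
  rw [star_add, star_smul, hw, hs.star_eq, star_zero, star_trivial, smul_neg] at hstar
  have hw0 : (4 : ℝ) • w = 0 := by
    linear_combination (norm := module) h - hstar
  obtain rfl := (smul_eq_zero.1 hw0).resolve_left four_ne_zero
  exact ⟨rfl, by simpa only [smul_zero, zero_add] using h⟩

open Matrix
open scoped ComplexOrder

variable {ι : Type*} [Fintype ι] [DecidableEq ι] {𝕜 : Type*} [RCLike 𝕜]

theorem eq_zero_of_eq_sub_conj {X a b : Matrix ι ι 𝕜} (hX : X ∈ unitaryGroup ι 𝕜)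
    (hb : b ∈ skewAdjoint (Matrix ι ι 𝕜)) (hXb : Commute X b) (h : b = a - star X * a * X) :
    b = 0 := by
  have hconj : X * b * star X = b := by
    rw [hXb.eq, mul_assoc, Unitary.mul_star_self_of_mem hX, mul_one]
  have htrace : (b * (star X * a * X)).trace = (b * a).trace := by
    rw [← mul_assoc, trace_mul_comm, ← mul_assoc, ← mul_assoc, hconj]
  refine trace_conjTranspose_mul_self_eq_zero_iff.1 ?_
  rw [← star_eq_conjTranspose, hb, neg_mul, trace_neg, neg_eq_zero]
  nth_rw 2 [h]
  rw [mul_sub, trace_sub, htrace, sub_self]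

end SliceDerivative

section OrthogonalSlice

variable {ι : Type*} [Fintype ι] [DecidableEq ι] {X : Matrix ι ι ℝ}
  {g : Matrix ι ι ℝ →ₗ[ℝ] Matrix ι ι ℝ}

open Matrix

/-- `sliceParam` for real matrices, with `g` meant to be a projection onto `skewCentralizer X`: the
self-adjoint part of the parameter leaves the orthogonal group, and its skew-adjoint part is split
by `g` into a motion within the centralizer of `X` and a conjugation. -/
noncomputable def orthogonalSlice (X : Matrix ι ι ℝ) (g : Matrix ι ι ℝ →ₗ[ℝ] Matrix ι ι ℝ) :
    Matrix ι ι ℝ → Matrix ι ι ℝ :=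
  sliceParam X (skewPart _ - g).toContinuousLinearMap g.toContinuousLinearMap
    (LinearMap.id - skewPart _).toContinuousLinearMap

theorem exists_hasFDerivAt_equiv_of_injective {E : Type*} [NormedAddCommGroup E]
    [NormedSpace ℝ E] [FiniteDimensional ℝ E] {f : E → E} {D : E →L[ℝ] E} {x : E}
    (hf : HasFDerivAt f D x) (hD : ∀ y, D y = 0 → y = 0) :
    ∃ L : E ≃L[ℝ] E, HasFDerivAt f (L : E →L[ℝ] E) x :=
  ⟨(LinearEquiv.ofInjectiveEndo (D : E →ₗ[ℝ] E)
    ((injective_iff_map_eq_zero D).2 hD)).toContinuousLinearEquiv, hf⟩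

theorem eq_zero_of_orthogonalSlice_deriv_eq_zero (hX : X ∈ orthogonalGroup ι ℝ)
    (hg : LinearMap.IsProj (skewCentralizer X) g) {Y : Matrix ι ι ℝ}
    (hY : (2 : ℝ) • ((skewPart _ Y - g Y) * X + X * g Y - X * (skewPart _ Y - g Y)) +
      X * (Y - skewPart _ Y) = 0) : Y = 0 := by
  obtain ⟨hb, hXb⟩ := mem_skewCentralizer.1 (hg.map_mem Y)
  have ha : skewPart _ Y - g Y ∈ skewAdjoint (Matrix ι ι ℝ) := sub_mem (skewPart_mem Y) hb
  have hXX := Unitary.star_mul_self_of_mem hX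
  have hderiv : (2 : ℝ) • (star X * (skewPart _ Y - g Y) * X + g Y - (skewPart _ Y - g Y)) +
      (Y - skewPart _ Y) = 0 := by
    rw [← mul_zero (star X), ← hY]
    simp only [mul_add, mul_sub, mul_smul_comm, ← mul_assoc, hXX, one_mul]
  obtain ⟨hw, hs⟩ := eq_zero_of_two_smul_add_eq_zero
    (sub_mem (add_mem (skewAdjoint.conjugate' ha X) hb) ha) (isSelfAdjoint_sub_skewPart Y) hderiv
  have hgY : g Y = 0 :=
    eq_zero_of_eq_sub_conj hX hb hXb (eq_sub_of_add_eq' (sub_eq_zero.1 hw))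
  have hYskew := sub_skewPart_eq_zero_iff.1 hs
  rw [hgY, skewPart_eq_self hYskew, sub_zero, add_zero, sub_eq_zero] at hw
  have hXY : X * Y = Y * X := by
    nth_rw 1 [← hw]
    rw [← mul_assoc, ← mul_assoc, Unitary.mul_star_self_of_mem hX, one_mul]
  rw [← hgY, hg.map_id Y (mem_skewCentralizer.2 ⟨hYskew, hXY⟩)]

theorem hasFDerivAt_orthogonalSlice (hX : X ∈ orthogonalGroup ι ℝ)
    (hg : LinearMap.IsProj (skewCentralizer X) g) :
    ∃ L : Matrix ι ι ℝ ≃L[ℝ] Matrix ι ι ℝ,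
      HasFDerivAt (orthogonalSlice X g) (L : Matrix ι ι ℝ →L[ℝ] Matrix ι ι ℝ) 0 :=
  exists_hasFDerivAt_equiv_of_injective (hasFDerivAt_sliceParam X _ _ _)
    fun _ hY => eq_zero_of_orthogonalSlice_deriv_eq_zero hX hg hY

end OrthogonalSlice

section ConjStable

variable {ι : Type*} [Fintype ι] [DecidableEq ι]

open Matrix

/-- `S` consists of orthogonal matrices, is stable under conjugation by orthogonal matrices, and
contains all orthogonal matrices that are close to some `X ∈ S` and generate the same algebra
as `X`. -/
structure IsConjStable (S : Set (Matrix ι ι ℝ)) : Prop where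
  mem_orthogonalGroup : ∀ X ∈ S, X ∈ orthogonalGroup ι ℝ
  conj_mem : ∀ U ∈ orthogonalGroup ι ℝ, ∀ X ∈ S, U * X * star U ∈ S
  eventually_mem : ∀ X ∈ S, ∀ᶠ Y in 𝓝 X, Y ∈ orthogonalGroup ι ℝ →
    Algebra.adjoin ℝ {Y} = Algebra.adjoin ℝ {X} → Y ∈ S

theorem finrank_adjoin_conj {U : Matrix ι ι ℝ} (hU : U ∈ orthogonalGroup ι ℝ)
    (X : Matrix ι ι ℝ) : Module.finrank ℝ (Algebra.adjoin ℝ {U * X * star U}) =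
      Module.finrank ℝ (Algebra.adjoin ℝ {X}) :=
  finrank_adjoin_singleton_map (Unitary.conjStarAlgAut ℝ (Matrix ι ι ℝ) ⟨U, hU⟩) X

theorem skewCodim_conj {U : Matrix ι ι ℝ} (hU : U ∈ orthogonalGroup ι ℝ) (X : Matrix ι ι ℝ) :
    skewCodim (U * X * star U) = skewCodim X :=
  skewCodim_map (Unitary.conjStarAlgAut ℝ (Matrix ι ι ℝ) ⟨U, hU⟩) X

variable {S : Set (Matrix ι ι ℝ)}

theorem IsConjStable.conj_mem_iff (hS : IsConjStable S) {U X : Matrix ι ι ℝ}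
    (hU : U ∈ orthogonalGroup ι ℝ) : U * X * star U ∈ S ↔ X ∈ S := by
  refine ⟨fun h => ?_, hS.conj_mem U hU X⟩
  have h' := hS.conj_mem (star U) (Unitary.star_mem hU) _ h
  rwa [star_star, mul_assoc, mul_assoc, mul_assoc, Unitary.star_mul_self_of_mem hU, mul_one,
    ← mul_assoc, Unitary.star_mul_self_of_mem hU, one_mul] at h'

theorem IsConjStable.cayley_mul_mem_iff (hS : IsConjStable S) {a s Z : Matrix ι ι ℝ}
    (ha : a ∈ skewAdjoint (Matrix ι ι ℝ)) (hs : IsSelfAdjoint s) (hnorm : ‖s‖ < 2)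
    (hZ : Z ∈ orthogonalGroup ι ℝ) :
    cayley a * Z * (1 + s) * cayley (-a) ∈ S ↔ s = 0 ∧ Z ∈ S := by
  have hU := cayley_mem_unitaryGroup ha
  rw [← star_cayley ha (isUnit_one_sub_of_mem_skewAdjoint ha), mul_assoc (cayley a),
    hS.conj_mem_iff hU]
  refine ⟨fun h => ?_, fun ⟨hs0, h⟩ => by rwa [hs0, add_zero, mul_one]⟩
  have hone : 1 + s ∈ orthogonalGroup ι ℝ := by
    have hmem := mul_mem (Unitary.star_mem hZ) (hS.mem_orthogonalGroup _ h)
    rwa [← mul_assoc, Unitary.star_mul_self_of_mem hZ, one_mul] at hmem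
  obtain rfl := eq_zero_of_one_add_mem_unitary hs hnorm hone
  exact ⟨rfl, by rwa [add_zero, mul_one] at h⟩

theorem mul_cayley_mem_adjoin_iff {X b : Matrix ι ι ℝ} (hX : X ∈ orthogonalGroup ι ℝ)
    (hb : b ∈ skewAdjoint (Matrix ι ι ℝ)) :
    X * cayley b ∈ Algebra.adjoin ℝ {X} ↔ b ∈ skewAdjoin X := by
  have hXmem := Algebra.self_mem_adjoin_singleton ℝ X
  refine ⟨fun h => ⟨hb, ?_⟩, fun h => mul_mem hXmem (cayley_mem_subalgebra h.2)⟩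
  refine mem_subalgebra_of_cayley_mem (isUnit_one_sub_of_mem_skewAdjoint hb) ?_
  have hXinv : Ring.inverse X * X = 1 :=
    Ring.inverse_mul_cancel X (Unitary.isUnit_coe (U := ⟨X, hX⟩))
  rw [← one_mul (cayley b), ← hXinv, mul_assoc]
  exact mul_mem (inverse_mem_subalgebra hXmem) h

theorem tendsto_mul_cayley (X : Matrix ι ι ℝ) : Tendsto (fun b => X * cayley b) (𝓝 0) (𝓝 X) := by
  have h := (contDiffAt_cayley (A := Matrix ι ι ℝ)).continuousAt.tendsto.const_mul X
  rwa [cayley_zero, mul_one] at h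

theorem IsConjStable.eventually_mul_cayley_mem_iff (hS : IsConjStable S) {r : ℕ}
    (hr : ∀ X ∈ S, Module.finrank ℝ (Algebra.adjoin ℝ {X}) = r) {X : Matrix ι ι ℝ} (hX : X ∈ S) :
    ∀ᶠ b in 𝓝 0, b ∈ skewCentralizer X → (X * cayley b ∈ S ↔ b ∈ skewAdjoin X) := by
  have hXO := hS.mem_orthogonalGroup X hX
  have hnear := (eventually_mem_adjoin_singleton_of_commute hXO).and (hS.eventually_mem X hX)
  filter_upwards [(tendsto_mul_cayley X).eventually hnear] with b ⟨hadjoin, hmem⟩ hb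
  rw [mem_skewCentralizer] at hb
  have hO : X * cayley b ∈ orthogonalGroup ι ℝ := mul_mem hXO (cayley_mem_unitaryGroup hb.1)
  have hle : Algebra.adjoin ℝ {X} ≤ Algebra.adjoin ℝ {X * cayley b} :=
    Algebra.adjoin_singleton_le (hadjoin hO ((Commute.refl X).mul_right (commute_cayley hb.2)))
  rw [← mul_cayley_mem_adjoin_iff hXO hb.1]
  constructor <;> intro h
  · rw [Subalgebra.eq_of_le_of_finrank_eq hle ((hr X hX).trans (hr _ h).symm)]
    exact Algebra.self_mem_adjoin_singleton ℝ _
  · exact hmem hO (le_antisymm (Algebra.adjoin_singleton_le h) hle)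

theorem eventually_norm_sub_skewPart_lt_two :
    ∀ᶠ Y in 𝓝 (0 : Matrix ι ι ℝ), ‖Y - skewPart _ Y‖ < 2 := by
  have hcont := (skewPart (Matrix ι ι ℝ)).continuous_of_finiteDimensional
  refine ContinuousAt.eventually_lt (by fun_prop) continuousAt_const ?_
  rw [map_zero, sub_zero, norm_zero]
  exact two_pos

theorem IsConjStable.isSliceParametrization (hS : IsConjStable S) {r : ℕ}
    (hr : ∀ X ∈ S, Module.finrank ℝ (Algebra.adjoin ℝ {X}) = r) {X : Matrix ι ι ℝ} (hX : X ∈ S)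
    {g : Matrix ι ι ℝ →ₗ[ℝ] Matrix ι ι ℝ} (hg : LinearMap.IsProj (skewCentralizer X) g) :
    IsSliceParametrization (orthogonalSlice X g) S
      (skewAdjoint.submodule ℝ (Matrix ι ι ℝ) ⊓ (skewAdjoin X).comap g) where
  contDiffAt := contDiffAt_sliceParam X _ _ _
  hasFDerivAt := hasFDerivAt_orthogonalSlice (hS.mem_orthogonalGroup X hX) hg
  mem_iff := by
    have hg0 : Tendsto g (𝓝 0) (𝓝 0) := g.continuous_of_finiteDimensional.tendsto' 0 0 (map_zero g)
    filter_upwards [eventually_norm_sub_skewPart_lt_two,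
      hg0.eventually (hS.eventually_mul_cayley_mem_iff hr hX)] with Y hY hmem
    have hb := (mem_skewCentralizer.1 (hg.map_mem Y)).1
    refine (hS.cayley_mul_mem_iff (sub_mem (skewPart_mem Y) hb) (isSelfAdjoint_sub_skewPart Y) hY
      (mul_mem (hS.mem_orthogonalGroup X hX) (cayley_mem_unitaryGroup hb))).trans ?_
    rw [sub_skewPart_eq_zero_iff, hmem (hg.map_mem Y)]
    rfl

end ConjStable

section Strata

variable {ι : Type*} [Fintype ι] [DecidableEq ι] {S : Set (Matrix ι ι ℝ)}

open Matrix

theorem skewCodim_le_finrank_skewAdjoint (X : Matrix ι ι ℝ) :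
    skewCodim X ≤ Module.finrank ℝ (skewAdjoint.submodule ℝ (Matrix ι ι ℝ)) :=
  (Nat.sub_le _ _).trans (Submodule.finrank_mono inf_le_left)

theorem IsConjStable.isSmoothSubmanifold (hS : IsConjStable S) {r c : ℕ}
    (hr : ∀ X ∈ S, Module.finrank ℝ (Algebra.adjoin ℝ {X}) = r)
    (hc : ∀ X ∈ S, skewCodim X = c) :
    IsSmoothSubmanifold S (Module.finrank ℝ (skewAdjoint.submodule ℝ (Matrix ι ι ℝ)) - c) := by
  refine isSmoothSubmanifold_of_isSliceParametrization fun X hX => ?_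
  obtain ⟨g, hg⟩ := exists_isProj (skewCentralizer X)
  refine ⟨_, _, sliceParam_zero _ _ _ _, hS.isSliceParametrization hr hX hg, ?_⟩
  have hdim := finrank_inf_comap_add_finrank hg (skewAdjoin_le_skewCentralizer X) inf_le_left
  rw [← skewCodim_add_finrank_skewAdjoin, hc X hX] at hdim
  omega

theorem IsConjStable.stratum (hS : IsConjStable S) (r c : ℕ) :
    IsConjStable {X ∈ S | Module.finrank ℝ (Algebra.adjoin ℝ {X}) = r ∧ skewCodim X = c} where
  mem_orthogonalGroup X hX := hS.mem_orthogonalGroup X hX.1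
  conj_mem U hU X hX := ⟨hS.conj_mem U hU X hX.1, (finrank_adjoin_conj hU X).trans hX.2.1,
    (skewCodim_conj hU X).trans hX.2.2⟩
  eventually_mem X hX := by
    filter_upwards [hS.eventually_mem X hX.1] with Y hY hYO hYX
    exact ⟨hY hYO hYX, by rw [hYX, hX.2.1], by rw [skewCodim_eq_of_adjoin_eq hYX, hX.2.2]⟩

end Strata

section OrthogonalWithDet

open Matrix

theorem det_eq_one_or_neg_one {ι : Type*} [Fintype ι] [DecidableEq ι] {X : Matrix ι ι ℝ}
    (hX : X ∈ orthogonalGroup ι ℝ) : X.det = 1 ∨ X.det = -1 := by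
  have hdet := (Unitary.mem_iff.1 (det_of_mem_unitary hX)).1
  rw [star_trivial] at hdet
  exact mul_self_eq_one_iff.1 hdet

theorem eventually_det_eq {ι : Type*} [Fintype ι] [DecidableEq ι] {X : Matrix ι ι ℝ}
    (hX : X ∈ orthogonalGroup ι ℝ) : ∀ᶠ Y in 𝓝 X, Y ∈ orthogonalGroup ι ℝ → Y.det = X.det := by
  have hcont : Tendsto (fun Y : Matrix ι ι ℝ => Y.det) (𝓝 X) (𝓝 X.det) :=
    (continuous_id.matrix_det).tendsto X
  filter_upwards [hcont (Metric.ball_mem_nhds _ two_pos)] with Y hY hYO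
  rw [Set.mem_preimage, Metric.mem_ball, Real.dist_eq] at hY
  rcases det_eq_one_or_neg_one hX with h | h <;>
    rcases det_eq_one_or_neg_one hYO with h' | h' <;> rw [h, h'] at hY ⊢ <;> norm_num at hY

variable {n : ℕ} {δ : ℝ}

theorem isConjStable_orthogonalWithDet : IsConjStable (orthogonalWithDet n δ) where
  mem_orthogonalGroup _ hX := hX.1
  conj_mem U hU X hX := by
    refine ⟨mul_mem (mul_mem hU hX.1) (Unitary.star_mem hU), ?_⟩
    rw [det_mul_right_comm, Unitary.mul_star_self_of_mem hU, one_mul, hX.2]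
  eventually_mem X hX := by
    filter_upwards [eventually_det_eq hX.1] with Y hY hYO _
    exact ⟨hYO, (hY hYO).trans hX.2⟩

theorem isSliceParametrization_orthogonalWithDet {X : Matrix (Fin n) (Fin n) ℝ}
    (hX : X ∈ orthogonalWithDet n δ) :
    IsSliceParametrization (sliceParam X 0 (skewPart _).toContinuousLinearMap
        (LinearMap.id - skewPart _).toContinuousLinearMap)
      (orthogonalWithDet n δ) (skewAdjoint.submodule ℝ (Matrix (Fin n) (Fin n) ℝ)) where
  contDiffAt := contDiffAt_sliceParam _ _ _ _
  hasFDerivAt := by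
    refine exists_hasFDerivAt_equiv_of_injective (hasFDerivAt_sliceParam _ _ _ _) fun Y hY => ?_
    change (2 : ℝ) • (0 * X + X * skewPart _ Y - X * 0) + X * (Y - skewPart _ Y) = 0 at hY
    have hderiv : (2 : ℝ) • skewPart _ Y + (Y - skewPart _ Y) = 0 := by
      rw [← mul_zero (star X), ← hY]
      simp only [zero_mul, zero_add, mul_zero, sub_zero, mul_add, mul_smul_comm, ← mul_assoc,
        Unitary.star_mul_self_of_mem hX.1, one_mul]
    obtain ⟨hskew, hself⟩ := eq_zero_of_two_smul_add_eq_zero (skewPart_mem Y)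
      (isSelfAdjoint_sub_skewPart Y) hderiv
    rwa [hskew, sub_zero] at hself
  mem_iff := by
    have hskew0 : Tendsto (skewPart (Matrix (Fin n) (Fin n) ℝ)) (𝓝 0) (𝓝 0) :=
      (skewPart _).continuous_of_finiteDimensional.tendsto' 0 0 (map_zero _)
    filter_upwards [eventually_norm_sub_skewPart_lt_two,
      ((tendsto_mul_cayley X).comp hskew0).eventually (eventually_det_eq hX.1)] with Y hY hdet
    have hO := mul_mem hX.1 (cayley_mem_unitaryGroup (skewPart_mem Y))
    refine (isConjStable_orthogonalWithDet.cayley_mul_mem_iff (zero_mem _)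
      (isSelfAdjoint_sub_skewPart Y) hY hO).trans ?_
    rw [sub_skewPart_eq_zero_iff]
    exact and_iff_left ⟨hO, (hdet hO).trans hX.2⟩

theorem isSmoothSubmanifold_orthogonalWithDet : IsSmoothSubmanifold (orthogonalWithDet n δ)
    (Module.finrank ℝ (skewAdjoint.submodule ℝ (Matrix (Fin n) (Fin n) ℝ))) :=
  isSmoothSubmanifold_of_isSliceParametrization fun _ hX =>
    ⟨_, _, sliceParam_zero _ _ _ _, isSliceParametrization_orthogonalWithDet hX, rfl⟩

theorem IsConjStable.hasCodimIn {S : Set (Matrix (Fin n) (Fin n) ℝ)} (hS : IsConjStable S)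
    (hsub : S ⊆ orthogonalWithDet n δ) {c : ℕ} (hlower : ∀ X ∈ S, c ≤ skewCodim X)
    (hexists : ∃ X ∈ S, skewCodim X = c) : HasCodimIn S (orthogonalWithDet n δ) c := by
  set D := Module.finrank ℝ (skewAdjoint.submodule ℝ (Matrix (Fin n) (Fin n) ℝ))
  set N := Module.finrank ℝ (Matrix (Fin n) (Fin n) ℝ)
  let stratum (i : Fin (N + 1) × Set.Icc c D) : Set (Matrix (Fin n) (Fin n) ℝ) :=
    {X ∈ S | Module.finrank ℝ (Algebra.adjoin ℝ {X}) = i.1 ∧ skewCodim X = i.2}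
  have hmem {X : Matrix (Fin n) (Fin n) ℝ} (hX : X ∈ S) :
      ∃ i, X ∈ stratum i ∧ (i.2 : ℕ) = skewCodim X :=
    ⟨⟨⟨_, Nat.lt_succ_of_le (Submodule.finrank_le (Algebra.adjoin ℝ {X}).toSubmodule)⟩,
      ⟨_, hlower X hX, skewCodim_le_finrank_skewAdjoint X⟩⟩, ⟨hX, rfl, rfl⟩, rfl⟩
  refine ⟨hsub, D, isSmoothSubmanifold_orthogonalWithDet, _, inferInstance, stratum,
    fun i => D - i.2, ?_, ?_, ?_, ?_, ?_⟩
  · exact Set.Subset.antisymm (fun X hX => Set.mem_iUnion.2 ((hmem hX).imp fun _ => And.left))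
      (Set.iUnion_subset fun _ _ hX => hX.1)
  · refine fun i j hij => Set.disjoint_left.2 fun X hi hj => hij (Prod.ext ?_ (Subtype.ext ?_))
    · exact Fin.ext (hi.2.1.symm.trans hj.2.1)
    · exact hi.2.2.symm.trans hj.2.2
  · exact fun i => (hS.stratum i.1 i.2).isSmoothSubmanifold (fun _ hX => hX.2.1) fun _ hX => hX.2.2
  · exact fun i => (Nat.add_le_add_left i.2.2.1 _).trans (Nat.sub_add_cancel i.2.2.2).le
  · obtain ⟨X, hX, hXc⟩ := hexists
    obtain ⟨i, hXi, hi⟩ := hmem hX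
    have hic : (i.2 : ℕ) = c := hi.trans hXc
    exact ⟨i, ⟨X, hXi⟩, (congrArg _ hic.symm).trans (Nat.sub_add_cancel i.2.2.2)⟩

end OrthogonalWithDet

section Eigenvalue

variable {ι : Type*} [Fintype ι] [DecidableEq ι] {X Y : Matrix ι ι ℝ} {z : ℂ}

open Matrix

theorem complexify_aeval_mulVec_of_mulVec_eq_smul {v : ι → ℂ} (hz : complexify X *ᵥ v = z • v)
    (p : Polynomial ℝ) : complexify (Polynomial.aeval X p) *ᵥ v = Polynomial.aeval z p • v := by
  have hp : complexify (Polynomial.aeval X p) = Polynomial.aeval (complexify X) p :=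
    (Polynomial.aeval_algHom_apply (complexify : Matrix ι ι ℝ →⋆ₐ[ℝ] _).toAlgHom X p).symm
  rw [hp, ← Polynomial.aeval_map_algebraMap ℂ, aeval_mulVec_of_mulVec_eq_smul hz,
    Polynomial.eval_map_algebraMap]

theorem finrank_eigenspace_complexify (hX : X ∈ orthogonalGroup ι ℝ) (z : ℂ) :
    Module.finrank ℂ (eigenspace (toLin' (complexify X)) z) =
      (complexify X).charpoly.rootMultiplicity z :=
  have := isStarNormal_of_mem_unitary (Unitary.map_mem complexify hX)
  finrank_eigenspace_toLin' _ z

theorem exists_mulVec_eq_smul_of_rootMultiplicity_pos {𝕜 : Type*} [Field 𝕜] {A : Matrix ι ι 𝕜}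
    {z : 𝕜} (h : 0 < A.charpoly.rootMultiplicity z) : ∃ v ≠ 0, A *ᵥ v = z • v := by
  have hroot := (Polynomial.rootMultiplicity_pos A.charpoly_monic.ne_zero).1 h
  rw [← charpoly_toLin', ← hasEigenvalue_iff_isRoot_charpoly] at hroot
  obtain ⟨v, hv⟩ := hroot.exists_hasEigenvector
  exact ⟨v, hv.2, mem_eigenspace_iff.1 hv.1⟩

theorem rootMultiplicity_le_rootMultiplicity_aeval (hX : X ∈ orthogonalGroup ι ℝ)
    {p : Polynomial ℝ} (hp : Polynomial.aeval X p ∈ orthogonalGroup ι ℝ) :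
    (complexify X).charpoly.rootMultiplicity z ≤
      (complexify (Polynomial.aeval X p)).charpoly.rootMultiplicity (Polynomial.aeval z p) := by
  rw [← finrank_eigenspace_complexify hX, ← finrank_eigenspace_complexify hp]
  refine Submodule.finrank_mono fun v hv => ?_
  rw [mem_eigenspace_iff, toLin'_apply] at hv ⊢
  exact complexify_aeval_mulVec_of_mulVec_eq_smul hv p

theorem charpoly_complexify_conj {U : Matrix ι ι ℝ} (hU : U ∈ orthogonalGroup ι ℝ)
    (X : Matrix ι ι ℝ) :
    (complexify (U * X * star U)).charpoly = (complexify X).charpoly := by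
  have hconj := charpoly_units_conj (Unitary.toUnits ⟨U, hU⟩) X
  rw [← coe_units_inv] at hconj
  exact (charpoly_map _ _).trans ((congrArg _ hconj).trans (charpoly_map _ _).symm)

theorem eq_one_or_eq_neg_one_of_mulVec_eq_smul (hX : X ∈ orthogonalGroup ι ℝ) {v : ι → ℂ}
    (hv : v ≠ 0) (hz : complexify X *ᵥ v = z • v) (him : z.im = 0) : z = 1 ∨ z = -1 := by
  have hnorm := norm_eq_one_of_mulVec_eq_smul (Unitary.map_mem complexify hX) hv hz
  obtain ⟨x, rfl⟩ : ∃ x : ℝ, (x : ℂ) = z := ⟨z.re, Complex.ext rfl him.symm⟩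
  rw [Complex.norm_real, Real.norm_eq_abs, abs_eq zero_le_one] at hnorm
  exact_mod_cast hnorm

theorem aeval_im_eq_zero (p : Polynomial ℝ) (hz : z.im = 0) : (Polynomial.aeval z p).im = 0 := by
  obtain ⟨x, rfl⟩ : ∃ x : ℝ, (x : ℂ) = z := ⟨z.re, Complex.ext rfl hz.symm⟩
  rw [← Complex.coe_algebraMap, Polynomial.aeval_algebraMap_apply]
  exact Complex.ofReal_im _

theorem eq_or_im_ne_zero_of_isJointEigenvalue (hX : X ∈ orthogonalGroup ι ℝ)
    (hY : Y ∈ orthogonalGroup ι ℝ) (hXY : ‖X - Y‖ < 2) {w : ℂ}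
    (h : IsJointEigenvalue (complexify X) (complexify Y) z w) (him : z.im = 0 ↔ w.im = 0) :
    z = w ∨ z.im ≠ 0 ∧ w.im ≠ 0 := by
  by_cases hz : z.im = 0
  · have hzw := h.norm_sub_le
    rw [← map_sub, norm_complexify] at hzw
    obtain ⟨v, hv, hvX, hvY⟩ := h
    left
    rcases eq_one_or_eq_neg_one_of_mulVec_eq_smul hX hv hvX hz with rfl | rfl <;>
      rcases eq_one_or_eq_neg_one_of_mulVec_eq_smul hY hv hvY (him.1 hz) with rfl | rfl
    · rfl
    · norm_num at hzw; linarith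
    · norm_num at hzw; linarith
    · rfl
  · exact Or.inr ⟨hz, him.not.1 hz⟩

theorem exists_isJointEigenvalue_rootMultiplicity_le (hX : X ∈ orthogonalGroup ι ℝ)
    (hY : Y ∈ orthogonalGroup ι ℝ) (hYX : Algebra.adjoin ℝ {Y} = Algebra.adjoin ℝ {X})
    (hz : 0 < (complexify X).charpoly.rootMultiplicity z) :
    ∃ w, IsJointEigenvalue (complexify X) (complexify Y) z w ∧ (z.im = 0 ↔ w.im = 0) ∧
      (complexify X).charpoly.rootMultiplicity z ≤
        (complexify Y).charpoly.rootMultiplicity w := by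
  have hmemY : Y ∈ Algebra.adjoin ℝ {X} := hYX ▸ Algebra.self_mem_adjoin_singleton ℝ Y
  have hmemX : X ∈ Algebra.adjoin ℝ {Y} := hYX ▸ Algebra.self_mem_adjoin_singleton ℝ X
  rw [Algebra.adjoin_singleton_eq_range_aeval] at hmemX hmemY
  obtain ⟨⟨p, rfl⟩, ⟨q, hq⟩⟩ := And.intro hmemY hmemX
  obtain ⟨v, hv, hvX⟩ := exists_mulVec_eq_smul_of_rootMultiplicity_pos hz
  have hvY := complexify_aeval_mulVec_of_mulVec_eq_smul hvX p
  have hzq : z = Polynomial.aeval (Polynomial.aeval z p) q := by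
    refine smul_left_injective ℂ hv (hvX.symm.trans ?_)
    have hvX' := complexify_aeval_mulVec_of_mulVec_eq_smul hvY q
    exact (congrArg (complexify · *ᵥ v) hq.symm).trans hvX'
  exact ⟨_, ⟨v, hv, hvX, hvY⟩, ⟨aeval_im_eq_zero p, fun h => hzq ▸ aeval_im_eq_zero q h⟩,
    rootMultiplicity_le_rootMultiplicity_aeval hX hY⟩

end Eigenvalue

section DoubleEigenvalue

open Matrix

variable {n : ℕ} {δ : ℝ}

theorem isDerogatory_iff_exists_isDoubleEigenvalue {X : Matrix (Fin n) (Fin n) ℝ}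
    (hX : X ∈ orthogonalGroup (Fin n) ℝ) : IsDerogatory X ↔ ∃ z, IsDoubleEigenvalue X z :=
  exists_congr fun z => iff_of_eq (congrArg (1 < ·) (finrank_eigenspace_complexify hX z))

/-- The orthogonal matrices of determinant `δ` with a double eigenvalue satisfying `Q`. -/
def doubleEigenvalueLocus (n : ℕ) (δ : ℝ) (Q : ℂ → Prop) : Set (Matrix (Fin n) (Fin n) ℝ) :=
  {X ∈ orthogonalWithDet n δ | ∃ z, Q z ∧ IsDoubleEigenvalue X z}

theorem setOf_isDerogatory_eq_doubleEigenvalueLocus :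
    {X ∈ orthogonalWithDet n δ | IsDerogatory X} = doubleEigenvalueLocus n δ fun _ => True := by
  ext X
  refine and_congr_right fun hX => ?_
  simp only [isDerogatory_iff_exists_isDoubleEigenvalue hX.1, true_and]

theorem isConjStable_doubleEigenvalueLocus {Q : ℂ → Prop}
    (hQ : ∀ z w : ℂ, z.im ≠ 0 → w.im ≠ 0 → Q z → Q w) :
    IsConjStable (doubleEigenvalueLocus n δ Q) where
  mem_orthogonalGroup X hX := hX.1.1
  conj_mem U hU X hX := by
    refine ⟨isConjStable_orthogonalWithDet.conj_mem U hU X hX.1, ?_⟩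
    obtain ⟨z, hz, hX⟩ := hX.2
    exact ⟨z, hz, hX.trans_eq (congrArg _ (charpoly_complexify_conj hU X).symm)⟩
  eventually_mem X hX := by
    obtain ⟨hXN, z, hz, hXz⟩ := hX
    filter_upwards [isConjStable_orthogonalWithDet.eventually_mem X hXN,
      Metric.ball_mem_nhds X two_pos] with Y hY hdist hYO hYX
    rw [Metric.mem_ball', dist_eq_norm] at hdist
    obtain ⟨w, hjoint, him, hle⟩ :=
      exists_isJointEigenvalue_rootMultiplicity_le hXN.1 hYO hYX (two_pos.trans_le hXz)
    refine ⟨hY hYO hYX, w, ?_, hXz.trans hle⟩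
    rcases eq_or_im_ne_zero_of_isJointEigenvalue hXN.1 hYO hdist hjoint him with rfl | ⟨hzi, hwi⟩
    · exact hz
    · exact hQ z w hzi hwi hz

end DoubleEigenvalue

section SkewCodimBounds

theorem finrank_map_add_finrank_inf_ker {K V W : Type*} [DivisionRing K] [AddCommGroup V]
    [Module K V] [AddCommGroup W] [Module K W] (f : V →ₗ[K] W) (C : Submodule K V)
    [FiniteDimensional K C] :
    Module.finrank K (C.map f) + Module.finrank K (C ⊓ LinearMap.ker f : Submodule K V) =
      Module.finrank K C := by
  rw [← (f.domRestrict C).finrank_range_add_finrank_ker, LinearMap.range_domRestrict,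
    LinearMap.ker_domRestrict, ← Submodule.map_comap_subtype, Submodule.finrank_map_subtype_eq]

variable {A : Type*} [Ring A] [StarRing A] [Algebra ℝ A] [StarModule ℝ A] [FiniteDimensional ℝ A]
  {B : Type*} [AddCommGroup B] [Module ℝ B] [FiniteDimensional ℝ B] {x : A}

theorem finrank_le_skewCodim_add_finrank (g : A →ₗ[ℝ] B) {V K : Submodule ℝ B}
    (hV : V ≤ (skewCentralizer x).map g) (hK : skewAdjoin x ≤ K.comap g) :
    Module.finrank ℝ V ≤ skewCodim x + Module.finrank ℝ K := by
  have hdim := finrank_map_add_finrank_inf_ker (K.mkQ ∘ₗ g) (skewCentralizer x)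
  have hdimV := finrank_map_add_finrank_inf_ker K.mkQ V
  rw [LinearMap.ker_comp, Submodule.ker_mkQ, Submodule.map_comp] at hdim
  rw [Submodule.ker_mkQ] at hdimV
  have hmap := Submodule.finrank_mono (Submodule.map_mono (f := K.mkQ) hV)
  have hadj := Submodule.finrank_mono (le_inf (skewAdjoin_le_skewCentralizer x) hK)
  have hinf := Submodule.finrank_mono (inf_le_right : V ⊓ K ≤ K)
  have hcodim := skewCodim_add_finrank_skewAdjoin x
  omega

theorem skewCodim_add_finrank_le_finrank (g : A →ₗ[ℝ] B) {V K : Submodule ℝ B}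
    (hV : (skewCentralizer x).map g ≤ V) (hKV : K ≤ V)
    (hK : skewCentralizer x ⊓ K.comap g ≤ skewAdjoin x) :
    skewCodim x + Module.finrank ℝ K ≤ Module.finrank ℝ V := by
  have hdim := finrank_map_add_finrank_inf_ker (K.mkQ ∘ₗ g) (skewCentralizer x)
  have hdimV := finrank_map_add_finrank_inf_ker K.mkQ V
  rw [LinearMap.ker_comp, Submodule.ker_mkQ, Submodule.map_comp] at hdim
  rw [Submodule.ker_mkQ, inf_eq_right.2 hKV] at hdimV
  have hmap := Submodule.finrank_mono (Submodule.map_mono (f := K.mkQ) hV)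
  have hadj := Submodule.finrank_mono hK
  have hcodim := skewCodim_add_finrank_skewAdjoin x
  omega

end SkewCodimBounds

section SkewDimension

/-- The linear map that reads off the entries of a skew-symmetric matrix above the diagonal. -/
def upperEntries (ι : Type*) [LinearOrder ι] :
    skewAdjoint.submodule ℝ (Matrix ι ι ℝ) →ₗ[ℝ] ({x : ι × ι // x.1 < x.2} → ℝ) :=
  (LinearMap.pi fun x => Matrix.entryLinearMap ℝ ℝ x.1.1 x.1.2) ∘ₗ Submodule.subtype _

theorem upperEntries_bijective (ι : Type*) [LinearOrder ι] :
    Function.Bijective (upperEntries ι) := by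
  constructor
  · refine (injective_iff_map_eq_zero _).2 fun ⟨Y, hY⟩ h => Subtype.ext (Matrix.ext fun i j => ?_)
    have hupper (i j : ι) (hij : i < j) : Y i j = 0 := congrFun h ⟨(i, j), hij⟩
    have hskew (i j : ι) : Y j i = -Y i j := congrFun (congrFun hY i) j
    rcases lt_trichotomy i j with hij | rfl | hji
    · exact hupper i j hij
    · exact self_eq_neg.1 (hskew i i)
    · exact (hskew j i).trans (neg_eq_zero.2 (hupper j i hji))
  · intro t
    let U : Matrix ι ι ℝ := Matrix.of fun i j => if h : i < j then t ⟨(i, j), h⟩ else 0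
    refine ⟨⟨U - star U, ?_⟩, funext fun x => ?_⟩
    · exact (star_sub _ _).trans (by rw [star_star, neg_sub])
    · change U x.1.1 x.1.2 - star (U x.1.2 x.1.1) = t x
      simp [U, x.2, x.2.not_gt]

theorem finrank_skewAdjoint_matrix_real (p : ℕ) :
    Module.finrank ℝ (skewAdjoint.submodule ℝ (Matrix (Fin p) (Fin p) ℝ)) = p.choose 2 := by
  rw [(LinearEquiv.ofBijective _ (upperEntries_bijective (Fin p))).finrank_eq,
    Module.finrank_fintype_fun_eq_card]
  have hcard : Fintype.card {x : Fin p × Fin p // x.1 < x.2} = ∑ j : Fin p, (j : ℕ) := by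
    rw [Fintype.card_subtype, Finset.card_filter, Fintype.sum_prod_type_right]
    simp only [← Finset.card_filter, Finset.filter_gt_eq_Iio, Fin.card_Iio]
  rw [hcard, Fin.sum_univ_eq_sum_range (fun j => j), Nat.choose_two_right]
  exact Finset.sum_range_id p

theorem two_mul_finrank_skewAdjoint (A : Type*) [Ring A] [StarRing A] [Algebra ℂ A]
    [StarModule ℂ A] [FiniteDimensional ℝ A] :
    2 * Module.finrank ℝ (skewAdjoint.submodule ℝ A) = Module.finrank ℝ A := by
  have hbij : Function.Bijective (skewAdjoint.negISMul (A := A)) := by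
    refine ⟨fun a b h => Subtype.ext ?_, fun a => ⟨⟨Complex.I • (a : A), ?_⟩, Subtype.ext ?_⟩⟩
    · rw [← skewAdjoint.I_smul_neg_I a, h, skewAdjoint.I_smul_neg_I]
    · simp [skewAdjoint.mem_iff]
    · simp [smul_smul]
  have : Module.Finite ℝ (selfAdjoint A) :=
    inferInstanceAs (Module.Finite ℝ (selfAdjoint.submodule ℝ A))
  have : Module.Finite ℝ (skewAdjoint A) :=
    inferInstanceAs (Module.Finite ℝ (skewAdjoint.submodule ℝ A))
  rw [(StarModule.decomposeProdAdjoint ℝ A).finrank_eq, Module.finrank_prod,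
    ← (LinearEquiv.ofBijective _ hbij).finrank_eq, two_mul]
  rfl

theorem finrank_skewAdjoint_matrix_complex (ι : Type*) [Fintype ι] :
    Module.finrank ℝ (skewAdjoint.submodule ℝ (Matrix ι ι ℂ)) =
      Fintype.card ι * Fintype.card ι := by
  classical
  have h := two_mul_finrank_skewAdjoint (Matrix ι ι ℂ)
  rw [Module.finrank_matrix, Complex.finrank_real_complex] at h
  omega

end SkewDimension

section Eigenbasis

open Matrix
open scoped ComplexOrder

variable {ι κ : Type*} [Fintype ι] [Fintype κ] [DecidableEq κ] {𝕜 : Type*} [RCLike 𝕜]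
  {A : Matrix ι ι 𝕜} {z : 𝕜} {W : Matrix ι κ 𝕜}

/-- The columns of `W` form an orthonormal basis of the eigenspace of `A` for `z`. -/
structure IsOrthonormalEigenbasis (A : Matrix ι ι 𝕜) (z : 𝕜) (W : Matrix ι κ 𝕜) : Prop where
  conjTranspose_mul_self : Wᴴ * W = 1
  mul_eq_smul : A * W = z • W
  mulVec_conjTranspose_mulVec : ∀ v, A *ᵥ v = z • v → W *ᵥ Wᴴ *ᵥ v = v

theorem exists_isOrthonormalEigenbasis [DecidableEq ι] (A : Matrix ι ι 𝕜) [IsStarNormal A]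
    (z : 𝕜) : ∃ W : Matrix ι (Fin (A.charpoly.rootMultiplicity z)) 𝕜,
      IsOrthonormalEigenbasis A z W := by
  set S : Submodule 𝕜 (EuclideanSpace 𝕜 ι) :=
    (eigenspace (toLin' A) z).comap (WithLp.linearEquiv 2 𝕜 (ι → 𝕜)).toLinearMap
  have hfinrank : Module.finrank 𝕜 S = A.charpoly.rootMultiplicity z :=
    ((WithLp.linearEquiv 2 𝕜 (ι → 𝕜)).ofSubmodule' _).finrank_eq.trans
      (finrank_eigenspace_toLin' A z)
  let b := (stdOrthonormalBasis 𝕜 S).reindex (finCongr hfinrank)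
  have hb (j) : A *ᵥ (b j).1.ofLp = z • (b j).1.ofLp := mem_eigenspace_iff.1 (b j).2
  refine ⟨of fun i j => (b j).1 i, ?_, ?_, fun v hv => ?_⟩
  · ext i j
    have h := orthonormal_iff_ite.1 b.orthonormal i j
    rw [Submodule.coe_inner, EuclideanSpace.inner_eq_star_dotProduct, dotProduct_comm] at h
    exact h.trans (Matrix.one_apply).symm
  · ext i j
    exact congrFun (hb j) i
  · have hsum := congrArg (fun x : S => x.1.ofLp)
      (b.sum_repr' ⟨WithLp.toLp 2 v, mem_eigenspace_iff.2 hv⟩)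
    ext i
    rw [AddSubmonoidClass.coe_finsetSum, WithLp.ofLp_sum] at hsum
    refine .trans ?_ (congrFun hsum i)
    rw [Finset.sum_apply, mulVec, dotProduct]
    refine Finset.sum_congr rfl fun j _ => (mul_comm _ _).trans (congrArg (· * (b j).1 i) ?_)
    rw [Submodule.coe_inner, EuclideanSpace.inner_eq_star_dotProduct, dotProduct_comm]
    rfl

theorem IsOrthonormalEigenbasis.conjTranspose_mul_eq_smul (hW : IsOrthonormalEigenbasis A z W)
    [DecidableEq ι] (hA : A ∈ unitaryGroup ι 𝕜) : Wᴴ * A = z • Wᴴ := by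
  have hstar : star z • (Wᴴ * A) = Wᴴ := by
    rw [← Matrix.smul_mul, ← conjTranspose_smul, ← hW.mul_eq_smul, conjTranspose_mul,
      Matrix.mul_assoc, ← star_eq_conjTranspose A, Unitary.star_mul_self_of_mem hA, Matrix.mul_one]
  have hnorm : (z * star z) • (1 : Matrix κ κ 𝕜) = 1 := by
    nth_rw 2 [← hW.conjTranspose_mul_self]
    rw [← hstar, smul_mul, Matrix.mul_assoc, hW.mul_eq_smul, Matrix.mul_smul, smul_smul,
      hW.conjTranspose_mul_self, mul_comm]
  calc Wᴴ * A = (z * star z) • (1 : Matrix κ κ 𝕜) * (Wᴴ * A) := by rw [hnorm, Matrix.one_mul]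
    _ = z • Wᴴ := by rw [smul_mul, Matrix.one_mul, mul_smul, hstar]

theorem IsOrthonormalEigenbasis.commute (hW : IsOrthonormalEigenbasis A z W) [DecidableEq ι]
    (hA : A ∈ unitaryGroup ι 𝕜) (T : Matrix κ κ 𝕜) : Commute A (W * T * Wᴴ) := by
  rw [commute_iff_eq, Matrix.mul_assoc _ _ A, hW.conjTranspose_mul_eq_smul hA, ← Matrix.mul_assoc,
    ← Matrix.mul_assoc, hW.mul_eq_smul, smul_mul, smul_mul, Matrix.mul_smul]

theorem IsOrthonormalEigenbasis.aeval_mul (hW : IsOrthonormalEigenbasis A z W) [DecidableEq ι]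
    (p : Polynomial 𝕜) : Polynomial.aeval A p * W = p.eval z • W := by
  ext i j
  have hcol : A *ᵥ W.col j = z • W.col j :=
    funext fun i => congrFun (congrFun hW.mul_eq_smul i) j
  exact congrFun (aeval_mulVec_of_mulVec_eq_smul hcol p) i

end Eigenbasis

section Compression

open Matrix

variable {ι κ : Type*} {𝕜 : Type*} [RCLike 𝕜]

theorem mul_mul_conjTranspose_mem_skewAdjoint [Fintype κ] {T : Matrix κ κ 𝕜}
    (hT : T ∈ skewAdjoint (Matrix κ κ 𝕜)) (W : Matrix ι κ 𝕜) :
    W * T * Wᴴ ∈ skewAdjoint (Matrix ι ι 𝕜) := by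
  rw [skewAdjoint.mem_iff, star_eq_conjTranspose] at hT ⊢
  simp only [conjTranspose_mul, conjTranspose_conjTranspose, hT, Matrix.neg_mul,
    Matrix.mul_neg, Matrix.mul_assoc]

variable [Fintype ι]

/-- The compression of a square matrix to the span of the columns of `W`, as a real linear map. -/
noncomputable def compression (W : Matrix ι κ 𝕜) : Matrix ι ι 𝕜 →ₗ[ℝ] Matrix κ κ 𝕜 :=
  mulRightLinearMap κ ℝ W ∘ₗ mulLeftLinearMap ι ℝ Wᴴ

theorem compression_apply (W : Matrix ι κ 𝕜) (Y : Matrix ι ι 𝕜) :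
    compression W Y = Wᴴ * Y * W := rfl

theorem compression_mem_skewAdjoint {Y : Matrix ι ι 𝕜} (hY : Y ∈ skewAdjoint (Matrix ι ι 𝕜))
    (W : Matrix ι κ 𝕜) : compression W Y ∈ skewAdjoint (Matrix κ κ 𝕜) := by
  simpa only [conjTranspose_conjTranspose, compression_apply] using
    mul_mul_conjTranspose_mem_skewAdjoint hY Wᴴ

theorem compression_mul_mul_conjTranspose [Fintype κ] [DecidableEq κ] {W : Matrix ι κ 𝕜}
    (hW : Wᴴ * W = 1) (T : Matrix κ κ 𝕜) : compression W (W * T * Wᴴ) = T := by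
  rw [compression_apply, ← Matrix.mul_assoc, ← Matrix.mul_assoc, hW, Matrix.one_mul,
    Matrix.mul_assoc, hW, Matrix.mul_one]

theorem IsOrthonormalEigenbasis.exists_compression_eq_smul_one [Fintype κ] [DecidableEq κ]
    [DecidableEq ι] {A Y : Matrix ι ι 𝕜} {z : 𝕜} {W : Matrix ι κ 𝕜}
    (hW : IsOrthonormalEigenbasis A z W) (hY : Y ∈ Algebra.adjoin 𝕜 {A}) :
    ∃ c : 𝕜, compression W Y = c • 1 := by
  rw [Algebra.adjoin_singleton_eq_range_aeval] at hY
  obtain ⟨p, rfl⟩ := hY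
  refine ⟨p.eval z, ?_⟩
  change Wᴴ * Polynomial.aeval A p * W = _
  rw [Matrix.mul_assoc, hW.aeval_mul, Matrix.mul_smul, hW.conjTranspose_mul_self]

end Compression

section JointEigenvalueUnique

open Matrix

variable {ι κ : Type*} [Fintype ι]

theorem IsJointEigenvalue.eq_of_finrank_eigenspace_le_one [DecidableEq ι] {𝕜 : Type*} [Field 𝕜]
    {A B : Matrix ι ι 𝕜} {u u' w : 𝕜}
    (hw : Module.finrank 𝕜 (eigenspace (toLin' B) w) ≤ 1) (h : IsJointEigenvalue A B u w)
    (h' : IsJointEigenvalue A B u' w) : u = u' := by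
  obtain ⟨⟨v, hv, hA, hB⟩, ⟨v', hv', hA', hB'⟩⟩ := And.intro h h'
  obtain ⟨e, he⟩ := finrank_le_one_iff.1 hw
  obtain ⟨c, hc⟩ := he ⟨v, mem_eigenspace_iff.2 hB⟩
  obtain ⟨c', hc'⟩ := he ⟨v', mem_eigenspace_iff.2 hB'⟩
  replace hc : c • e.1 = v := congrArg Subtype.val hc
  replace hc' : c' • e.1 = v' := congrArg Subtype.val hc'
  rw [← hc'] at hA' hv'
  have hc0 := (smul_ne_zero_iff.1 hv').1
  have he : A *ᵥ e.1 = u' • e.1 := by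
    rwa [mulVec_smul, smul_comm, smul_right_inj hc0] at hA'
  refine smul_left_injective 𝕜 hv (hA.symm.trans ?_)
  rw [← hc, mulVec_smul, he, smul_comm]

theorem IsJointEigenvalue.eq_of_compression_eq_smul_one [Fintype κ] [DecidableEq κ] {𝕜 : Type*}
    [RCLike 𝕜] {A B : Matrix ι ι 𝕜} {W : Matrix ι κ 𝕜} {u z a : 𝕜}
    (h : IsJointEigenvalue A B u z) (hW : IsOrthonormalEigenbasis B z W)
    (ha : compression W A = a • 1) : u = a := by
  obtain ⟨v, hv, hA, hB⟩ := h
  have hWv := hW.mulVec_conjTranspose_mulVec v hB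
  refine smul_left_injective 𝕜 (fun h0 : Wᴴ *ᵥ v = 0 => hv ?_) ?_
  · rw [← hWv, h0, mulVec_zero]
  · calc u • Wᴴ *ᵥ v = Wᴴ *ᵥ A *ᵥ W *ᵥ Wᴴ *ᵥ v := by rw [hWv, hA, mulVec_smul]
      _ = compression W A *ᵥ Wᴴ *ᵥ v := by
          simp only [compression_apply, mulVec_mulVec, Matrix.mul_assoc]
      _ = a • Wᴴ *ᵥ v := by rw [ha, smul_mulVec, one_mulVec]

theorem IsJointEigenvalue.conj [DecidableEq ι] {X Y : Matrix ι ι ℝ} {u w : ℂ}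
    (h : IsJointEigenvalue (complexify Y) (complexify X) u w) :
    IsJointEigenvalue (complexify Y) (complexify X) (star u) (star w) := by
  have hconj {A : Matrix ι ι ℝ} {v : ι → ℂ} {c : ℂ} (hc : complexify A *ᵥ v = c • v) :
      complexify A *ᵥ star v = star c • star v := by
    rw [← star_smul, ← hc]
    ext i
    simp [mulVec, dotProduct, complexify_apply]
  obtain ⟨v, hv, hY, hX⟩ := h
  exact ⟨star v, star_ne_zero.2 hv, hconj hY, hconj hX⟩

end JointEigenvalueUnique

section SkewCodimOrthogonal

open Matrix

variable {ι κ : Type*} [Fintype ι] [DecidableEq ι] [Fintype κ] [DecidableEq κ]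
  {X Y : Matrix ι ι ℝ}

theorem isStarNormal_of_mem_skewAdjoint {A : Type*} [NonUnitalNonAssocRing A] [StarRing A] {x : A}
    (hx : x ∈ skewAdjoint A) : IsStarNormal x where
  star_comm_self := by
    rw [skewAdjoint.mem_iff.1 hx]
    exact (Commute.refl x).neg_left

theorem complexify_mem_skewAdjoint (hY : Y ∈ skewAdjoint (Matrix ι ι ℝ)) :
    complexify Y ∈ skewAdjoint (Matrix ι ι ℂ) := by
  rw [skewAdjoint.mem_iff] at hY ⊢
  rw [← map_star, hY, map_neg]

theorem complexify_mem_adjoin (hY : Y ∈ Algebra.adjoin ℝ {X}) :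
    complexify Y ∈ Algebra.adjoin ℂ {complexify X} := by
  rw [Algebra.adjoin_singleton_eq_range_aeval] at hY ⊢
  obtain ⟨p, rfl⟩ := hY
  refine ⟨p.map (algebraMap ℝ ℂ), (Polynomial.aeval_map_algebraMap ℂ _ p).trans ?_⟩
  exact Polynomial.aeval_algHom_apply (complexify : Matrix ι ι ℝ →⋆ₐ[ℝ] _).toAlgHom X p

theorem mem_adjoin_of_compression_eq_smul_one (hX : X ∈ orthogonalGroup ι ℝ) {z a : ℂ}
    {W : Matrix ι κ ℂ} (hW : IsOrthonormalEigenbasis (complexify X) z W)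
    (hsimple : ∀ w, w ≠ z → w ≠ star z → (complexify X).charpoly.rootMultiplicity w ≤ 1)
    (hY : Y ∈ skewCentralizer X) (ha : compression W (complexify Y) = a • 1) :
    Y ∈ Algebra.adjoin ℝ {X} := by
  obtain ⟨hYskew, hXY⟩ := mem_skewCentralizer.1 hY
  have := isStarNormal_of_mem_skewAdjoint (complexify_mem_skewAdjoint hYskew)
  have := isStarNormal_of_mem_unitary (Unitary.map_mem complexify hX)
  refine mem_adjoin_of_complexify_mem_adjoin <|
    mem_adjoin_singleton_of_isJointEigenvalue (hXY.symm.map complexify) fun {u u' w} h h' => ?_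
  rcases eq_or_ne w z with rfl | hwz
  · rw [h.eq_of_compression_eq_smul_one hW ha, h'.eq_of_compression_eq_smul_one hW ha]
  rcases eq_or_ne w (star z) with rfl | hwz'
  · replace h := h.conj
    replace h' := h'.conj
    rw [star_star] at h h'
    exact star_injective ((h.eq_of_compression_eq_smul_one hW ha).trans
      (h'.eq_of_compression_eq_smul_one hW ha).symm)
  · refine IsJointEigenvalue.eq_of_finrank_eigenspace_le_one ?_ h h'
    exact (finrank_eigenspace_complexify hX w).trans_le (hsimple w hwz hwz')

end SkewCodimOrthogonal

section RealEigenvalue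

open Matrix

theorem conjTranspose_map_ofReal {ι κ : Type*} (W : Matrix ι κ ℝ) :
    (W.map (algebraMap ℝ ℂ))ᴴ = Wᴴ.map (algebraMap ℝ ℂ) := by
  ext i j
  simp

variable {ι κ : Type*} [Fintype ι] [DecidableEq ι] [Fintype κ] [DecidableEq κ]
  {X : Matrix ι ι ℝ} {z : ℝ}

theorem rootMultiplicity_charpoly_complexify_ofReal (X : Matrix ι ι ℝ) (z : ℝ) :
    (complexify X).charpoly.rootMultiplicity (z : ℂ) = X.charpoly.rootMultiplicity z := by
  rw [complexify_apply, charpoly_map]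
  exact (Polynomial.eq_rootMultiplicity_map (algebraMap ℝ ℂ).injective z).symm

theorem exists_isOrthonormalEigenbasis_real (hX : X ∈ orthogonalGroup ι ℝ) (z : ℝ) :
    ∃ W : Matrix ι (Fin ((complexify X).charpoly.rootMultiplicity (z : ℂ))) ℝ,
      IsOrthonormalEigenbasis X z W := by
  have := isStarNormal_of_mem_unitary hX
  rw [rootMultiplicity_charpoly_complexify_ofReal]
  exact exists_isOrthonormalEigenbasis X z

theorem complexify_mulVec_eq_iff {v w : ι → ℂ} : complexify X *ᵥ v = w ↔
    (X *ᵥ fun i => (v i).re) = (fun i => (w i).re) ∧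
      (X *ᵥ fun i => (v i).im) = fun i => (w i).im := by
  simp only [funext_iff, Complex.ext_iff, mulVec, dotProduct, complexify_apply, map_apply,
    Complex.coe_algebraMap, Complex.re_sum, Complex.im_sum, Complex.re_ofReal_mul,
    Complex.im_ofReal_mul, forall_and]

theorem IsOrthonormalEigenbasis.map_ofReal {W : Matrix ι κ ℝ}
    (hW : IsOrthonormalEigenbasis X z W) :
    IsOrthonormalEigenbasis (complexify X) (z : ℂ) (W.map (algebraMap ℝ ℂ)) where
  conjTranspose_mul_self := by
    rw [conjTranspose_map_ofReal, ← Matrix.map_mul, hW.conjTranspose_mul_self]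
    exact map_one complexify
  mul_eq_smul := by
    rw [complexify_apply, ← Matrix.map_mul, hW.mul_eq_smul]
    ext i j
    simp
  mulVec_conjTranspose_mulVec v hv := by
    rw [mulVec_mulVec, conjTranspose_map_ofReal, ← Matrix.map_mul, ← complexify_apply,
      complexify_mulVec_eq_iff, ← mulVec_mulVec, ← mulVec_mulVec]
    obtain ⟨hre, him⟩ := complexify_mulVec_eq_iff.1 hv
    constructor <;> apply hW.mulVec_conjTranspose_mulVec
    · rw [hre]
      ext i
      simp
    · rw [him]
      ext i
      simp

theorem IsOrthonormalEigenbasis.finrank_skewAdjoint_le_skewCodim {W : Matrix ι κ ℝ}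
    (hW : IsOrthonormalEigenbasis X z W) (hX : X ∈ orthogonalGroup ι ℝ) :
    Module.finrank ℝ (skewAdjoint.submodule ℝ (Matrix κ κ ℝ)) ≤ skewCodim X := by
  have hle := finrank_le_skewCodim_add_finrank (x := X) (compression W)
    (V := skewAdjoint.submodule ℝ (Matrix κ κ ℝ)) (K := ⊥) (fun T hT => ?_) fun Y hY => ?_
  · rwa [finrank_bot, add_zero] at hle
  · exact ⟨W * T * Wᴴ, mem_skewCentralizer.2 ⟨mul_mul_conjTranspose_mem_skewAdjoint hT W,
      hW.commute hX T⟩, compression_mul_mul_conjTranspose hW.conjTranspose_mul_self T⟩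
  · obtain ⟨c, hc⟩ := hW.exists_compression_eq_smul_one (mem_skewAdjoin.1 hY).2
    have hskew := compression_mem_skewAdjoint (mem_skewAdjoin.1 hY).1 W
    have : IsAddTorsionFree (Matrix κ κ ℝ) := inferInstanceAs (IsAddTorsionFree (κ → κ → ℝ))
    rw [hc, skewAdjoint.mem_iff, star_smul, star_trivial, star_one, self_eq_neg] at hskew
    exact hc.trans hskew

theorem IsOrthonormalEigenbasis.skewCodim_le_finrank_skewAdjoint {W : Matrix ι κ ℝ}
    (hW : IsOrthonormalEigenbasis X z W) (hX : X ∈ orthogonalGroup ι ℝ)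
    (hsimple : ∀ w ≠ (z : ℂ), (complexify X).charpoly.rootMultiplicity w ≤ 1) :
    skewCodim X ≤ Module.finrank ℝ (skewAdjoint.submodule ℝ (Matrix κ κ ℝ)) := by
  have hle := skewCodim_add_finrank_le_finrank (x := X) (compression W)
    (V := skewAdjoint.submodule ℝ (Matrix κ κ ℝ)) (K := ⊥) ?_ bot_le fun Y hY => ?_
  · rwa [finrank_bot, add_zero] at hle
  · rintro _ ⟨Y, hY, rfl⟩
    exact compression_mem_skewAdjoint (mem_skewCentralizer.1 hY).1 W
  · refine ⟨(mem_skewCentralizer.1 hY.1).1, mem_adjoin_of_compression_eq_smul_one (a := 0) hX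
      hW.map_ofReal (fun w hw _ => hsimple w hw) hY.1 ?_⟩
    have hY0 : Wᴴ * Y * W = 0 := hY.2
    rw [compression_apply, conjTranspose_map_ofReal, complexify_apply, ← Matrix.map_mul,
      ← Matrix.map_mul, hY0, zero_smul, Matrix.map_zero _ (map_zero _)]

theorem choose_two_le_skewCodim (hX : X ∈ orthogonalGroup ι ℝ) (z : ℝ) :
    ((complexify X).charpoly.rootMultiplicity (z : ℂ)).choose 2 ≤ skewCodim X := by
  obtain ⟨W, hW⟩ := exists_isOrthonormalEigenbasis_real hX z
  rw [← finrank_skewAdjoint_matrix_real]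
  exact hW.finrank_skewAdjoint_le_skewCodim hX

theorem skewCodim_eq_choose_two (hX : X ∈ orthogonalGroup ι ℝ)
    (hsimple : ∀ w ≠ (z : ℂ), (complexify X).charpoly.rootMultiplicity w ≤ 1) :
    skewCodim X = ((complexify X).charpoly.rootMultiplicity (z : ℂ)).choose 2 := by
  refine le_antisymm ?_ (choose_two_le_skewCodim hX z)
  obtain ⟨W, hW⟩ := exists_isOrthonormalEigenbasis_real hX z
  rw [← finrank_skewAdjoint_matrix_real]
  exact hW.skewCodim_le_finrank_skewAdjoint hX hsimple

end RealEigenvalue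

section NonrealEigenvalue

open Matrix

variable {ι κ : Type*} [Fintype ι] [DecidableEq ι] [Fintype κ] [DecidableEq κ]
  {X : Matrix ι ι ℝ} {z : ℂ} {W : Matrix ι κ ℂ}

theorem IsOrthonormalEigenbasis.transpose_mul_self_eq_zero
    (hW : IsOrthonormalEigenbasis (complexify X) z W) (hX : X ∈ orthogonalGroup ι ℝ)
    (hz : z ^ 2 ≠ 1) : Wᵀ * W = 0 := by
  have hXX : (complexify X)ᵀ * complexify X = 1 := by
    rw [complexify_apply, ← transpose_map, ← Matrix.map_mul]
    exact (congrArg complexify (Unitary.star_mul_self_of_mem hX)).trans (map_one _)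
  have hsq : z ^ 2 • (Wᵀ * W) = Wᵀ * W := by
    calc z ^ 2 • (Wᵀ * W) = (complexify X * W)ᵀ * (complexify X * W) := by
          rw [hW.mul_eq_smul, transpose_smul, Matrix.smul_mul, Matrix.mul_smul, smul_smul, pow_two]
      _ = Wᵀ * ((complexify X)ᵀ * complexify X) * W := by
          rw [transpose_mul]; simp only [Matrix.mul_assoc]
      _ = Wᵀ * W := by rw [hXX, Matrix.mul_one]
  have hsub : (z ^ 2 - 1) • (Wᵀ * W) = 0 := by rw [sub_smul, hsq, one_smul, sub_self]
  exact (smul_eq_zero.1 hsub).resolve_left (sub_ne_zero.2 hz)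

/-- Twice the real part of a complex matrix, i.e. the sum of the matrix and its conjugate. -/
def twiceRe {ι : Type*} (M : Matrix ι ι ℂ) : Matrix ι ι ℝ := M.map fun a => 2 * a.re

theorem complexify_twiceRe (M : Matrix ι ι ℂ) :
    complexify (twiceRe M) = M + M.map (starRingEnd ℂ) := by
  ext i j
  simp [complexify_apply, twiceRe, Complex.add_conj]

theorem twiceRe_mem_skewAdjoint {ι : Type*} {M : Matrix ι ι ℂ}
    (hM : M ∈ skewAdjoint (Matrix ι ι ℂ)) : twiceRe M ∈ skewAdjoint (Matrix ι ι ℝ) := by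
  ext i j
  have hre : (M j i).re = -(M i j).re := congrArg Complex.re (congrFun (congrFun hM i) j)
  simp [twiceRe, hre]

theorem commute_twiceRe {M : Matrix ι ι ℂ} (h : Commute (complexify X) M) :
    Commute X (twiceRe M) := by
  have hconj : (starRingEnd ℂ).mapMatrix (complexify X) = complexify X := by
    ext i j
    simp [complexify_apply]
  have hinj : Function.Injective (complexify : Matrix ι ι ℝ →⋆ₐ[ℝ] _) :=
    map_injective (algebraMap ℝ ℂ).injective
  refine (commute_map_iff hinj).1 ?_
  rw [complexify_twiceRe]
  exact h.add_right (hconj ▸ h.map (starRingEnd ℂ).mapMatrix)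

theorem compression_complexify_twiceRe (hW : Wᴴ * W = 1) (hWW : Wᵀ * W = 0)
    (T : Matrix κ κ ℂ) : compression W (complexify (twiceRe (W * T * Wᴴ))) = T := by
  have hconj : Wᴴ.map (starRingEnd ℂ) = Wᵀ := by
    ext i j
    simp
  rw [complexify_twiceRe, map_add, compression_mul_mul_conjTranspose hW, add_eq_left,
    compression_apply, Matrix.map_mul, hconj, Matrix.mul_assoc, Matrix.mul_assoc, hWW,
    Matrix.mul_zero, Matrix.mul_zero]

theorem smul_one_mem_span_of_mem_skewAdjoint {A : Type*} [Ring A] [StarRing A] [Algebra ℂ A]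
    [StarModule ℂ A] {c : ℂ} (hc : c • (1 : A) ∈ skewAdjoint A) :
    c • (1 : A) ∈ Submodule.span ℝ {Complex.I • (1 : A)} := by
  rw [skewAdjoint.mem_iff, star_smul, star_one] at hc
  have hre : (c.re : ℂ) • (1 : A) = 0 := by
    rw [Complex.re_eq_add_conj, div_eq_inv_mul, mul_smul, add_smul, starRingEnd_apply, hc,
      add_neg_cancel, smul_zero]
  refine Submodule.mem_span_singleton.2 ⟨c.im, ?_⟩
  conv_rhs => rw [← Complex.re_add_im c, add_smul, hre, zero_add, mul_smul]
  exact (Complex.coe_smul _ _).symm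

theorem IsOrthonormalEigenbasis.finrank_skewAdjoint_le_skewCodim_add_one
    (hW : IsOrthonormalEigenbasis (complexify X) z W) (hX : X ∈ orthogonalGroup ι ℝ)
    (hz : z ^ 2 ≠ 1) :
    Module.finrank ℝ (skewAdjoint.submodule ℝ (Matrix κ κ ℂ)) ≤ skewCodim X + 1 := by
  refine (finrank_le_skewCodim_add_finrank (x := X)
    (compression W ∘ₗ complexify.toAlgHom.toLinearMap)
    (K := Submodule.span ℝ {Complex.I • 1}) (fun T hT => ?_) fun Y hY => ?_).trans
    (Nat.add_le_add_left ?_ _)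
  · have hcomm := hW.commute (Unitary.map_mem complexify hX) T
    exact ⟨twiceRe (W * T * Wᴴ), mem_skewCentralizer.2 ⟨twiceRe_mem_skewAdjoint
      (mul_mul_conjTranspose_mem_skewAdjoint hT W), commute_twiceRe hcomm⟩,
      compression_complexify_twiceRe hW.conjTranspose_mul_self
        (hW.transpose_mul_self_eq_zero hX hz) T⟩
  · obtain ⟨hskew, hadj⟩ := mem_skewAdjoin.1 hY
    obtain ⟨c, hc⟩ := hW.exists_compression_eq_smul_one (complexify_mem_adjoin hadj)
    have hcskew := compression_mem_skewAdjoint (complexify_mem_skewAdjoint hskew) W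
    change compression W (complexify Y) ∈ Submodule.span ℝ {Complex.I • 1}
    rw [hc] at hcskew ⊢
    exact smul_one_mem_span_of_mem_skewAdjoint hcskew
  · exact (finrank_span_le_card _).trans (by simp)

theorem IsOrthonormalEigenbasis.skewCodim_add_one_le_finrank_skewAdjoint [Nonempty κ]
    (hW : IsOrthonormalEigenbasis (complexify X) z W) (hX : X ∈ orthogonalGroup ι ℝ)
    (hsimple : ∀ w, w ≠ z → w ≠ star z → (complexify X).charpoly.rootMultiplicity w ≤ 1) :
    skewCodim X + 1 ≤ Module.finrank ℝ (skewAdjoint.submodule ℝ (Matrix κ κ ℂ)) := by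
  have hI : Complex.I • (1 : Matrix κ κ ℂ) ≠ 0 := smul_ne_zero Complex.I_ne_zero one_ne_zero
  rw [← finrank_span_singleton (K := ℝ) hI]
  refine skewCodim_add_finrank_le_finrank (compression W ∘ₗ complexify.toAlgHom.toLinearMap)
    ?_ ?_ fun Y hY => ?_
  · rintro _ ⟨Y, hY, rfl⟩
    exact compression_mem_skewAdjoint (complexify_mem_skewAdjoint (mem_skewCentralizer.1 hY).1) W
  · rw [Submodule.span_singleton_le_iff_mem]
    change star _ = -_
    simp
  · obtain ⟨r, hr⟩ := Submodule.mem_span_singleton.1 hY.2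
    rw [← smul_assoc] at hr
    exact ⟨(mem_skewCentralizer.1 hY.1).1,
      mem_adjoin_of_compression_eq_smul_one hX hW hsimple hY.1 hr.symm⟩

theorem mul_self_le_skewCodim_add_one (hX : X ∈ orthogonalGroup ι ℝ) (hz : z ^ 2 ≠ 1) :
    (complexify X).charpoly.rootMultiplicity z * (complexify X).charpoly.rootMultiplicity z ≤
      skewCodim X + 1 := by
  have := isStarNormal_of_mem_unitary (Unitary.map_mem complexify hX)
  obtain ⟨W, hW⟩ := exists_isOrthonormalEigenbasis (complexify X) z
  have hle := hW.finrank_skewAdjoint_le_skewCodim_add_one hX hz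
  rwa [finrank_skewAdjoint_matrix_complex, Fintype.card_fin] at hle

theorem skewCodim_add_one_eq_mul_self (hX : X ∈ orthogonalGroup ι ℝ) (hz : z ^ 2 ≠ 1)
    (hpos : 0 < (complexify X).charpoly.rootMultiplicity z)
    (hsimple : ∀ w, w ≠ z → w ≠ star z → (complexify X).charpoly.rootMultiplicity w ≤ 1) :
    skewCodim X + 1 =
      (complexify X).charpoly.rootMultiplicity z * (complexify X).charpoly.rootMultiplicity z := by
  refine le_antisymm ?_ (mul_self_le_skewCodim_add_one hX hz)
  have := isStarNormal_of_mem_unitary (Unitary.map_mem complexify hX)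
  have := Fin.pos_iff_nonempty.1 hpos
  obtain ⟨W, hW⟩ := exists_isOrthonormalEigenbasis (complexify X) z
  have hle := hW.skewCodim_add_one_le_finrank_skewAdjoint hX hsimple
  rwa [finrank_skewAdjoint_matrix_complex, Fintype.card_fin] at hle

end NonrealEigenvalue

section Parity

open Polynomial

theorem eval_zero_pos_of_monic {q : ℝ[X]} (hq : q.Monic) (hroots : ∀ x, 0 ≤ x → q.eval x ≠ 0) :
    0 < q.eval 0 := by
  by_contra! hneg
  have hdeg : 0 < q.degree := by
    by_contra! hdeg
    rw [eq_one_of_monic_natDegree_zero hq (natDegree_eq_zero_iff_degree_le_zero.2 hdeg),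
      eval_one] at hneg
    linarith
  have hlim := q.tendsto_atTop_of_leadingCoeff_nonneg hdeg (hq.leadingCoeff ▸ zero_le_one)
  obtain ⟨b, hb0, hb⟩ := ((eventually_ge_atTop (0 : ℝ)).and (hlim.eventually_ge_atTop 0)).exists
  obtain ⟨x, hx, hx0⟩ := intermediate_value_Icc hb0 q.continuous.continuousOn ⟨hneg, hb⟩
  exact hroots x hx.1 hx0

theorem odd_rootMultiplicity_of_eval_zero_neg {p : ℝ[X]} (hp : p.Monic) (h0 : p.eval 0 < 0) {a : ℝ}
    (ha : ∀ x, 0 ≤ x → p.eval x = 0 → x = a) : Odd (p.rootMultiplicity a) := by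
  obtain ⟨q, hq, hqa⟩ := exists_eq_pow_rootMultiplicity_mul_and_not_dvd p hp.ne_zero a
  have hqmonic : q.Monic := ((monic_X_sub_C a).pow _).of_mul_monic_left (hq ▸ hp)
  have hqpos : 0 < q.eval 0 := eval_zero_pos_of_monic hqmonic fun x hx hqx => by
    have hpx : p.eval x = 0 := by rw [hq, eval_mul, hqx, mul_zero]
    rw [ha x hx hpx] at hqx
    exact hqa (dvd_iff_isRoot.2 hqx)
  rw [← Nat.not_even_iff_odd]
  intro heven
  rw [hq, eval_mul, eval_pow] at h0
  exact h0.not_ge (mul_nonneg (heven.pow_nonneg _) hqpos.le)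

open Matrix

variable {ι : Type*} [Fintype ι] [DecidableEq ι] {X : Matrix ι ι ℝ}

theorem eq_one_of_eval_charpoly_eq_zero (hX : X ∈ orthogonalGroup ι ℝ) {x : ℝ} (hx : 0 ≤ x)
    (hroot : X.charpoly.eval x = 0) : x = 1 := by
  have hpos : 0 < X.charpoly.rootMultiplicity x :=
    (rootMultiplicity_pos X.charpoly_monic.ne_zero).2 hroot
  rw [← rootMultiplicity_charpoly_complexify_ofReal] at hpos
  obtain ⟨v, hv, hXv⟩ := exists_mulVec_eq_smul_of_rootMultiplicity_pos hpos
  have hnorm := norm_eq_one_of_mulVec_eq_smul (Unitary.map_mem complexify hX) hv hXv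
  rwa [Complex.norm_of_nonneg hx] at hnorm

theorem odd_rootMultiplicity_one (hX : X ∈ orthogonalGroup ι ℝ) (hdet : (-X).det = -1) :
    Odd (X.charpoly.rootMultiplicity 1) := by
  refine odd_rootMultiplicity_of_eval_zero_neg X.charpoly_monic ?_
    fun x hx => eq_one_of_eval_charpoly_eq_zero hX hx
  rw [eval_charpoly, map_zero, zero_sub, hdet]
  exact neg_one_lt_zero

theorem odd_rootMultiplicity_neg_one (hX : X ∈ orthogonalGroup ι ℝ) (hdet : X.det = -1) :
    Odd (X.charpoly.rootMultiplicity (-1)) := by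
  have hneg : -X ∈ orthogonalGroup ι ℝ := (-(⟨X, hX⟩ : orthogonalGroup ι ℝ)).2
  have := isStarNormal_of_mem_unitary hX
  have := isStarNormal_of_mem_unitary hneg
  have heq : eigenspace (toLin' X) (-1) = eigenspace (toLin' (-X)) 1 := by
    ext v
    simp only [mem_eigenspace_iff, toLin'_apply, neg_mulVec, neg_smul, one_smul, neg_eq_iff_eq_neg]
  rw [← finrank_eigenspace_toLin', heq, finrank_eigenspace_toLin']
  exact odd_rootMultiplicity_one hneg (by rwa [neg_neg])

theorem sq_ne_one_of_im_ne_zero {z : ℂ} (hz : z.im ≠ 0) : z ^ 2 ≠ 1 := by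
  rintro h
  rcases sq_eq_one_iff.1 h with rfl | rfl <;> simp at hz

theorem three_le_skewCodim_of_im_ne_zero (hX : X ∈ orthogonalGroup ι ℝ) {z : ℂ} (hz : z.im ≠ 0)
    (hmult : 2 ≤ (complexify X).charpoly.rootMultiplicity z) : 3 ≤ skewCodim X := by
  have hle := mul_self_le_skewCodim_add_one hX (sq_ne_one_of_im_ne_zero hz)
  have hsq := Nat.mul_self_le_mul_self hmult
  omega

theorem one_le_skewCodim (hX : X ∈ orthogonalGroup ι ℝ) {z : ℂ}
    (hmult : 2 ≤ (complexify X).charpoly.rootMultiplicity z) : 1 ≤ skewCodim X := by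
  by_cases hz : z.im = 0
  · obtain ⟨x, rfl⟩ : ∃ x : ℝ, (x : ℂ) = z := ⟨z.re, Complex.ext rfl hz.symm⟩
    exact (Nat.choose_pos hmult).trans_le (choose_two_le_skewCodim hX x)
  · exact Nat.one_le_ofNat.trans (three_le_skewCodim_of_im_ne_zero hX hz hmult)

theorem three_le_skewCodim_of_odd (hX : X ∈ orthogonalGroup ι ℝ) {z : ℝ}
    (hmult : 2 ≤ (complexify X).charpoly.rootMultiplicity (z : ℂ))
    (hodd : Odd (X.charpoly.rootMultiplicity z)) : 3 ≤ skewCodim X := by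
  refine le_trans ?_ (choose_two_le_skewCodim hX z)
  rw [rootMultiplicity_charpoly_complexify_ofReal] at hmult ⊢
  obtain ⟨k, hk⟩ := hodd
  exact Nat.choose_le_choose 2 (show 3 ≤ _ by omega)

theorem three_le_skewCodim (hX : X ∈ orthogonalGroup ι ℝ) {z : ℂ}
    (hmult : 2 ≤ (complexify X).charpoly.rootMultiplicity z) (hone : z = 1 → (-X).det = -1)
    (hneg : z = -1 → X.det = -1) : 3 ≤ skewCodim X := by
  by_cases hz : z.im = 0
  · obtain ⟨v, hv, hXv⟩ := exists_mulVec_eq_smul_of_rootMultiplicity_pos (two_pos.trans_le hmult)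
    rcases eq_one_or_eq_neg_one_of_mulVec_eq_smul hX hv hXv hz with rfl | rfl
    · refine three_le_skewCodim_of_odd (z := 1) hX ?_ (odd_rootMultiplicity_one hX (hone rfl))
      rwa [Complex.ofReal_one]
    · refine three_le_skewCodim_of_odd (z := -1) hX ?_ (odd_rootMultiplicity_neg_one hX (hneg rfl))
      rwa [Complex.ofReal_neg, Complex.ofReal_one]
  · exact three_le_skewCodim_of_im_ne_zero hX hz hmult

end Parity

section OrthogonalSpectrum

open Matrix

/-- The multiset `s` is the spectrum, with algebraic multiplicities, of some real orthogonal
`n × n` matrix. -/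
def IsOrthogonalSpectrum (n : ℕ) (s : Multiset ℂ) : Prop :=
  ∃ X ∈ orthogonalGroup (Fin n) ℝ, (complexify X).charpoly.roots = s

theorem isOrthogonalSpectrum_zero : IsOrthogonalSpectrum 0 0 :=
  ⟨1, one_mem _, by simp [charpoly]⟩

theorem isOrthogonalSpectrum_singleton {ε : ℝ} (hε : ε = 1 ∨ ε = -1) :
    IsOrthogonalSpectrum 1 {(ε : ℂ)} := by
  refine ⟨diagonal fun _ => ε, (mem_orthogonalGroup_iff _ _).2 ?_, ?_⟩
  · rw [diagonal_transpose, diagonal_mul_diagonal, ← diagonal_one]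
    exact congrArg diagonal (funext fun _ => mul_self_eq_one_iff.2 hε)
  · rw [complexify_apply, diagonal_map (map_zero _), charpoly_diagonal, Fin.prod_univ_one,
      Polynomial.roots_X_sub_C, Complex.coe_algebraMap]

theorem isOrthogonalSpectrum_pair {z : ℂ} (hz : ‖z‖ = 1) : IsOrthogonalSpectrum 2 {z, star z} := by
  have hsq : z.re * z.re + z.im * z.im = 1 := by
    rw [← Complex.normSq_apply, Complex.normSq_eq_norm_sq, hz, one_pow]
  refine ⟨!![z.re, -z.im; z.im, z.re], (mem_orthogonalGroup_iff _ _).2 ?_, ?_⟩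
  · ext i j
    fin_cases i <;> fin_cases j <;> simp [Matrix.mul_apply, mul_comm z.re z.im, hsq, add_comm]
  · have hcharpoly : (complexify !![z.re, -z.im; z.im, z.re]).charpoly =
        (Polynomial.X - Polynomial.C z) * (Polynomial.X - Polynomial.C (star z)) := by
      have htrace : (complexify !![z.re, -z.im; z.im, z.re]).trace = z + star z := by
        simp [complexify_apply, trace_fin_two, Complex.ext_iff]
      have hdet : (complexify !![z.re, -z.im; z.im, z.re]).det = z * star z := by
        simp [complexify_apply, det_fin_two, Complex.ext_iff, mul_comm]
      rw [charpoly_fin_two, htrace, hdet, map_add, map_mul]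
      ring
    have hne := Polynomial.X_sub_C_ne_zero z
    have hne' := Polynomial.X_sub_C_ne_zero (star z)
    rw [hcharpoly, Polynomial.roots_mul (mul_ne_zero hne hne'), Polynomial.roots_X_sub_C,
      Polynomial.roots_X_sub_C]
    rfl

theorem IsOrthogonalSpectrum.add {m n : ℕ} {s t : Multiset ℂ} (hs : IsOrthogonalSpectrum m s)
    (ht : IsOrthogonalSpectrum n t) : IsOrthogonalSpectrum (m + n) (s + t) := by
  obtain ⟨⟨X, hX, rfl⟩, ⟨Y, hY, rfl⟩⟩ := And.intro hs ht
  rw [mem_orthogonalGroup_iff] at hX hY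
  refine ⟨reindex finSumFinEquiv finSumFinEquiv (fromBlocks X 0 0 Y),
    (mem_orthogonalGroup_iff _ _).2 ?_, ?_⟩
  · rw [transpose_reindex, reindex_apply, reindex_apply, submatrix_mul_equiv,
      fromBlocks_transpose, fromBlocks_multiply]
    simp [hX, hY]
  · have hblocks : complexify (reindex finSumFinEquiv finSumFinEquiv (fromBlocks X 0 0 Y)) =
        reindex finSumFinEquiv finSumFinEquiv
          (fromBlocks (complexify X) 0 0 (complexify Y)) := by
      rw [complexify_apply, reindex_apply, ← submatrix_map, fromBlocks_map,
        Matrix.map_zero _ (map_zero _), Matrix.map_zero _ (map_zero _)]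
      rfl
    rw [hblocks, charpoly_reindex, charpoly_fromBlocks_zero₁₂, Polynomial.roots_mul]
    exact mul_ne_zero (charpoly_monic _).ne_zero (charpoly_monic _).ne_zero

theorem isOrthogonalSpectrum_replicate {ε : ℝ} (hε : ε = 1 ∨ ε = -1) (p : ℕ) :
    IsOrthogonalSpectrum p (Multiset.replicate p (ε : ℂ)) := by
  induction p with
  | zero => exact isOrthogonalSpectrum_zero
  | succ p ih =>
    rw [Multiset.replicate_add]
    exact ih.add (isOrthogonalSpectrum_singleton hε)

theorem isOrthogonalSpectrum_add_map_star (t : Multiset ℂ) (ht : ∀ z ∈ t, ‖z‖ = 1) :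
    IsOrthogonalSpectrum (t.card * 2) (t + t.map star) := by
  induction t using Multiset.induction_on with
  | empty => exact isOrthogonalSpectrum_zero
  | cons z t ih =>
    obtain ⟨hz, ht⟩ := Multiset.forall_mem_cons.1 ht
    have hsplit : z ::ₘ t + (z ::ₘ t).map star = t + t.map star + {z, star z} := by
      rw [Multiset.map_cons, Multiset.insert_eq_cons, ← Multiset.singleton_add,
        ← Multiset.singleton_add, ← Multiset.singleton_add]
      abel
    rw [Multiset.card_cons, add_mul, one_mul, hsplit]
    exact (ih ht).add (isOrthogonalSpectrum_pair hz)

theorem exists_finset_card_eq_of_norm_eq_one (k : ℕ) :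
    ∃ t : Finset ℂ, t.card = k ∧ ∀ z ∈ t, ‖z‖ = 1 ∧ 0 < z.im := by
  have hinf : {z : ℂ | ‖z‖ = 1 ∧ 0 < z.im}.Infinite := by
    refine Set.infinite_of_injOn_mapsTo (s := Set.Ioo (-1 : ℝ) 1)
      (f := fun x => (⟨x, √(1 - x ^ 2)⟩ : ℂ)) (fun x _ y _ h => congrArg Complex.re h)
      (fun x hx => ?_) (Set.Ioo_infinite (by norm_num))
    have hpos : 0 < 1 - x ^ 2 := sub_pos.2 ((sq_lt_one_iff_abs_lt_one x).2 (abs_lt.2 hx))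
    refine ⟨?_, Real.sqrt_pos.2 hpos⟩
    rw [Complex.norm_def, Complex.normSq_mk, Real.mul_self_sqrt hpos.le, ← pow_two,
      add_sub_cancel, Real.sqrt_one]
  obtain ⟨t, ht, hcard⟩ := hinf.exists_subset_card_eq k
  exact ⟨t, hcard, fun z hz => ht hz⟩

theorem im_ne_zero_of_mem_add_map_star {t : Multiset ℂ} (ht : ∀ z ∈ t, 0 < z.im) {w : ℂ}
    (hw : w ∈ t + t.map star) : w.im ≠ 0 := by
  rcases Multiset.mem_add.1 hw with hw | hw
  · exact (ht w hw).ne'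
  · obtain ⟨z, hz, rfl⟩ := Multiset.mem_map.1 hw
    exact neg_ne_zero.2 (ht z hz).ne'

theorem nodup_add_map_star {t : Multiset ℂ} (hnodup : t.Nodup) (ht : ∀ z ∈ t, 0 < z.im) :
    (t + t.map star).Nodup := by
  refine Multiset.nodup_add.2 ⟨hnodup, hnodup.map star_injective, ?_⟩
  refine Multiset.disjoint_left.2 fun hw hw' => ?_
  obtain ⟨z, hz, rfl⟩ := Multiset.mem_map.1 hw'
  exact (ht _ hw).not_gt (neg_lt_zero.2 (ht z hz))

end OrthogonalSpectrum

section Witnesses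

open Matrix Multiset

theorem det_eq_prod_roots_charpoly_complexify {ι : Type*} [Fintype ι] [DecidableEq ι]
    (X : Matrix ι ι ℝ) : (X.det : ℂ) = (complexify X).charpoly.roots.prod :=
  ((algebraMap ℝ ℂ).map_det X).trans (det_eq_prod_roots_charpoly (complexify X))

theorem prod_add_map_star_eq_one {t : Multiset ℂ} (ht : ∀ z ∈ t, ‖z‖ = 1) :
    (t + t.map star).prod = 1 := by
  have hstar : (t.map star).prod = star t.prod := (map_multiset_prod (starRingEnd ℂ) t).symm
  have hprod : ‖t.prod‖ = 1 := prod_induction (‖·‖ = 1) t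
    (fun z w hz hw => by rw [norm_mul, hz, hw, mul_one]) norm_one ht
  rw [prod_add, hstar]
  exact (Complex.mul_conj' _).trans (by rw [hprod, Complex.ofReal_one, one_pow])

theorem exists_mem_orthogonalWithDet_roots_charpoly {ε : ℝ} (hε : ε = 1 ∨ ε = -1) {n p q : ℕ}
    {t : Multiset ℂ} (ht : ∀ z ∈ t, ‖z‖ = 1) (hn : p + q + t.card * 2 = n) :
    ∃ X ∈ orthogonalWithDet n (ε ^ p * (-ε) ^ q), (complexify X).charpoly.roots =
      replicate p (ε : ℂ) + (replicate q (-ε : ℂ) + (t + t.map star)) := by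
  subst hn
  have hneg : -ε = 1 ∨ -ε = -1 := by rwa [neg_eq_iff_eq_neg, neg_inj, or_comm]
  obtain ⟨X, hX, hroots⟩ := ((isOrthogonalSpectrum_replicate hε p).add
    (isOrthogonalSpectrum_replicate hneg q)).add (isOrthogonalSpectrum_add_map_star t ht)
  rw [Complex.ofReal_neg, add_assoc (replicate p _)] at hroots
  refine ⟨X, ⟨hX, Complex.ofReal_injective ?_⟩, hroots⟩
  rw [det_eq_prod_roots_charpoly_complexify, hroots, prod_add, prod_add,
    prod_add_map_star_eq_one ht, prod_replicate, prod_replicate, mul_one]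
  push_cast
  rfl

theorem nodup_add_add_map_star {s t : Multiset ℂ} (hs : s.Nodup) (hs' : ∀ z ∈ s, z.im = 0)
    (ht : t.Nodup) (ht' : ∀ z ∈ t, 0 < z.im) : (s + (t + t.map star)).Nodup :=
  nodup_add.2 ⟨hs, nodup_add_map_star ht ht', disjoint_left.2 fun hw hw' =>
    im_ne_zero_of_mem_add_map_star ht' hw' (hs' _ hw)⟩

theorem exists_skewCodim_eq_choose_two {ε : ℝ} (hε : ε = 1 ∨ ε = -1) {n p q k : ℕ} (hq : q ≤ 1)
    (hn : p + q + k * 2 = n) : ∃ X ∈ orthogonalWithDet n (ε ^ p * (-ε) ^ q),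
      (complexify X).charpoly.rootMultiplicity (ε : ℂ) = p ∧ skewCodim X = p.choose 2 := by
  obtain ⟨t, rfl, ht⟩ := exists_finset_card_eq_of_norm_eq_one k
  obtain ⟨X, hX, hroots⟩ :=
    exists_mem_orthogonalWithDet_roots_charpoly hε (t := t.val) (fun z hz => (ht z hz).1) hn
  have him : ∀ z ∈ t.val, 0 < z.im := fun z hz => (ht z hz).2
  have hsimple := nodup_iff_count_le_one.1 <|
    nodup_add_add_map_star (show (replicate q (-ε : ℂ)).Nodup from List.nodup_replicate.2 hq)
      (fun w hw => by simp [eq_of_mem_replicate hw]) t.nodup him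
  have hnotMem : (ε : ℂ) ∉ replicate q (-ε : ℂ) + (t.val + t.val.map star) := by
    rw [mem_add, not_or]
    refine ⟨fun h => ?_, fun h => im_ne_zero_of_mem_add_map_star him h (Complex.ofReal_im ε)⟩
    have hε0 : (ε : ℂ) = 0 := self_eq_neg.1 (eq_of_mem_replicate h)
    rcases hε with rfl | rfl <;> norm_num at hε0
  have hmult : (complexify X).charpoly.rootMultiplicity (ε : ℂ) = p := by
    rw [← Polynomial.count_roots, hroots, count_add, count_replicate_self,
      count_eq_zero_of_notMem hnotMem, add_zero]
  refine ⟨X, hX, hmult, ?_⟩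
  rw [skewCodim_eq_choose_two hX.1 fun w hw => ?_, hmult]
  rw [← Polynomial.count_roots, hroots, count_add, count_replicate, if_neg hw.symm, zero_add]
  exact hsimple w

theorem exists_skewCodim_add_one_eq_mul_self {n q r k : ℕ} (hq : q ≤ 1)
    (hn : q + q + (r + (k + 1)) * 2 = n) :
    ∃ X ∈ orthogonalWithDet n ((-1) ^ q), ∃ z : ℂ, z.im ≠ 0 ∧
      (complexify X).charpoly.rootMultiplicity z = r + 1 ∧
        skewCodim X + 1 = (r + 1) * (r + 1) := by
  obtain ⟨t, htcard, ht⟩ := exists_finset_card_eq_of_norm_eq_one (k + 1)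
  obtain ⟨z, hzt⟩ : t.Nonempty := Finset.card_pos.1 (by omega)
  have hnorm : ∀ w ∈ replicate r z + t.val, ‖w‖ = 1 := fun w hw => (ht w <| by
    rcases mem_add.1 hw with hw | hw
    exacts [eq_of_mem_replicate hw ▸ hzt, hw]).1
  obtain ⟨X, hX, hroots⟩ := exists_mem_orthogonalWithDet_roots_charpoly
    (n := n) (p := q) (q := q) (.inl rfl) hnorm
    (by rwa [card_add, card_replicate, Finset.card_val, htcard])
  rw [one_pow, one_mul] at hX
  have hzim := (ht z hzt).2
  set s := replicate q 1 + replicate q (-1) + (t.val + t.val.map star)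
  have hroots' : (complexify X).charpoly.roots =
      replicate r z + replicate r (star z) + s := by
    rw [hroots, Multiset.map_add, map_replicate, Complex.ofReal_one,
      add_add_add_comm (replicate r z), ← add_assoc, add_left_comm]
  have hsnodup : s.Nodup := by
    refine nodup_add_add_map_star (nodup_add.2 ⟨List.nodup_replicate.2 hq,
      List.nodup_replicate.2 hq, disjoint_left.2 fun hw hw' => ?_⟩) (fun w hw => ?_)
      t.nodup fun z hz => (ht z hz).2
    · have heq := (eq_of_mem_replicate hw).symm.trans (eq_of_mem_replicate hw')
      norm_num at heq
    · rcases mem_add.1 hw with hw | hw <;> simp [eq_of_mem_replicate hw]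
  have hzs : z ∈ s := mem_add.2 (.inr (mem_add.2 (.inl hzt)))
  have hzstar : z ≠ star z := fun h => hzim.ne' (Complex.conj_eq_iff_im.1 h.symm)
  have hmult : (complexify X).charpoly.rootMultiplicity z = r + 1 := by
    rw [← Polynomial.count_roots, hroots', count_add, count_add, count_replicate_self,
      count_replicate, if_neg hzstar.symm, count_eq_one_of_mem hsnodup hzs]
  refine ⟨X, hX, z, hzim.ne', hmult, ?_⟩
  rw [skewCodim_add_one_eq_mul_self hX.1 (sq_ne_one_of_im_ne_zero hzim.ne')
    (hmult ▸ r.succ_pos) fun w hw hw' => ?_, hmult]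
  rw [← Polynomial.count_roots, hroots', count_add, count_add, count_replicate, count_replicate,
    if_neg hw.symm, if_neg hw'.symm, zero_add, zero_add]
  exact nodup_iff_count_le_one.1 hsnodup w

end Witnesses

section Codimension

open Matrix

variable {n c : ℕ} {δ : ℝ} {Q : ℂ → Prop}

theorem hasCodimIn_doubleEigenvalueLocus
    (hQ : ∀ z w : ℂ, z.im ≠ 0 → w.im ≠ 0 → Q z → Q w)
    (hlower : ∀ X ∈ orthogonalWithDet n δ, ∀ z, Q z → IsDoubleEigenvalue X z → c ≤ skewCodim X)
    (hexists : ∃ X ∈ orthogonalWithDet n δ,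
      (∃ z, Q z ∧ IsDoubleEigenvalue X z) ∧ skewCodim X = c) :
    HasCodimIn (doubleEigenvalueLocus n δ Q) (orthogonalWithDet n δ) c := by
  obtain ⟨X, hX, hdouble, hc⟩ := hexists
  exact (isConjStable_doubleEigenvalueLocus hQ).hasCodimIn (fun _ h => h.1)
    (fun Y ⟨hY, z, hz, hYz⟩ => hlower Y hY z hz hYz) ⟨X, ⟨hX, hdouble⟩, hc⟩

theorem hasCodimIn_doubleEigenvalueLocus_choose_two {ε : ℝ} (hε : ε = 1 ∨ ε = -1) {p q k : ℕ}
    (hp : 2 ≤ p) (hq : q ≤ 1) (hn : p + q + k * 2 = n) (hdet : ε ^ p * (-ε) ^ q = δ)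
    (hQ : ∀ z w : ℂ, z.im ≠ 0 → w.im ≠ 0 → Q z → Q w) (hQε : Q ε)
    (hlower : ∀ X ∈ orthogonalWithDet n δ, ∀ z, Q z → IsDoubleEigenvalue X z →
      p.choose 2 ≤ skewCodim X) :
    HasCodimIn (doubleEigenvalueLocus n δ Q) (orthogonalWithDet n δ) (p.choose 2) := by
  obtain ⟨X, hX, hmult, hcodim⟩ := exists_skewCodim_eq_choose_two hε hq hn
  exact hasCodimIn_doubleEigenvalueLocus hQ hlower
    ⟨X, hdet ▸ hX, ⟨ε, hQε, hp.trans_eq hmult.symm⟩, hcodim⟩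

theorem hasCodimIn_isDerogatory_of_even_of_det_eq_one (hn : Even n) (hn2 : 2 ≤ n) :
    HasCodimIn {X ∈ orthogonalWithDet n 1 | IsDerogatory X} (orthogonalWithDet n 1) 1 := by
  rw [setOf_isDerogatory_eq_doubleEigenvalueLocus]
  obtain ⟨m, rfl⟩ := hn
  exact hasCodimIn_doubleEigenvalueLocus_choose_two (p := 2) (q := 0) (k := m - 1) (.inl rfl)
    le_rfl zero_le_one (by omega) (by norm_num) (fun _ _ _ _ => id) trivial
    fun X hX z _ hXz => one_le_skewCodim hX.1 hXz

theorem hasCodimIn_isDerogatory_of_even_of_det_eq_neg_one (hn : Even n) (hn4 : 4 ≤ n) :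
    HasCodimIn {X ∈ orthogonalWithDet n (-1) | IsDerogatory X} (orthogonalWithDet n (-1)) 3 := by
  rw [setOf_isDerogatory_eq_doubleEigenvalueLocus]
  have hdet (X : Matrix (Fin n) (Fin n) ℝ) : (-X).det = X.det := by
    rw [det_neg, Fintype.card_fin, hn.neg_one_pow, one_mul]
  obtain ⟨m, rfl⟩ := hn
  exact hasCodimIn_doubleEigenvalueLocus_choose_two (p := 3) (q := 1) (k := m - 2) (.inl rfl)
    (by norm_num) le_rfl (by omega) (by norm_num) (fun _ _ _ _ => id) trivial
    fun X hX z _ hXz =>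
      three_le_skewCodim hX.1 hXz (fun _ => (hdet X).trans hX.2) (fun _ => hX.2)

theorem hasCodimIn_isDerogatory_of_odd (hδ : δ = 1 ∨ δ = -1) (hn : Odd n) (hn3 : 3 ≤ n) :
    HasCodimIn {X ∈ orthogonalWithDet n δ | IsDerogatory X} (orthogonalWithDet n δ) 1 := by
  rw [setOf_isDerogatory_eq_doubleEigenvalueLocus]
  obtain ⟨m, rfl⟩ := hn
  exact hasCodimIn_doubleEigenvalueLocus_choose_two (ε := -δ) (p := 2) (q := 1) (k := m - 1)
    (by rcases hδ with rfl | rfl <;> norm_num) le_rfl le_rfl (by omega)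
    (by rcases hδ with rfl | rfl <;> norm_num) (fun _ _ _ _ => id) trivial
    fun X hX z _ hXz => one_le_skewCodim hX.1 hXz

theorem hasCodimIn_nonreal_doubleEigenvalueLocus (hδ : δ = 1 ∨ δ = -1) (hn : Even n) (hn4 : 4 ≤ n)
    (hn6 : δ = -1 → 6 ≤ n) :
    HasCodimIn (doubleEigenvalueLocus n δ fun z => z.im ≠ 0) (orthogonalWithDet n δ) 3 := by
  refine hasCodimIn_doubleEigenvalueLocus (fun _ _ _ hw _ => hw)
    (fun X hX z hz hXz => three_le_skewCodim_of_im_ne_zero hX.1 hz hXz) ?_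
  obtain ⟨m, rfl⟩ := hn
  obtain ⟨q, k, hq, hdet, hcard⟩ : ∃ q k : ℕ,
      q ≤ 1 ∧ (-1) ^ q = δ ∧ q + q + (1 + (k + 1)) * 2 = m + m := by
    rcases hδ with rfl | rfl
    · exact ⟨0, m - 2, zero_le_one, pow_zero _, by omega⟩
    · have := hn6 rfl
      exact ⟨1, m - 3, le_rfl, pow_one _, by omega⟩
  obtain ⟨X, hX, z, hz, hmult, hcodim⟩ := exists_skewCodim_add_one_eq_mul_self hq hcard
  exact ⟨X, hdet ▸ hX, ⟨z, hz, hmult.ge⟩, Nat.succ_injective hcodim⟩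

theorem hasCodimIn_ne_neg_det_doubleEigenvalueLocus (hδ : δ = 1 ∨ δ = -1) (hn : Odd n)
    (hn3 : 3 ≤ n) :
    HasCodimIn (doubleEigenvalueLocus n δ fun z => z ≠ -(δ : ℂ)) (orthogonalWithDet n δ) 3 := by
  have hdet (X : Matrix (Fin n) (Fin n) ℝ) : (-X).det = -X.det := by
    rw [det_neg, Fintype.card_fin, hn.neg_one_pow, neg_one_mul]
  obtain ⟨m, rfl⟩ := hn
  refine hasCodimIn_doubleEigenvalueLocus_choose_two (p := 3) (q := 0) (k := m - 1) hδ
    (by norm_num) zero_le_one (by omega) (by rcases hδ with rfl | rfl <;> norm_num)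
    (fun _ w _ hw _ h => hw (by simp [h])) (by rcases hδ with rfl | rfl <;> norm_num)
    fun X hX z hz hXz => three_le_skewCodim hX.1 hXz ?_ ?_
  · rintro rfl
    have hδ1 : δ = 1 := hδ.resolve_right fun h => hz (by simp [h])
    rw [hdet, hX.2, hδ1]
  · rintro rfl
    exact hX.2.trans (hδ.resolve_left fun h => hz (by simp [h]))

end Codimension

theorem mainTheorem2 (n : ℕ) (δ : ℝ) (hδ : δ = 1 ∨ δ = -1) :
    (Even n → 2 ≤ n → δ = 1 →
      HasCodimIn {X ∈ orthogonalWithDet n δ | IsDerogatory X} (orthogonalWithDet n δ) 1) ∧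
    (Even n → 4 ≤ n → δ = -1 →
      HasCodimIn {X ∈ orthogonalWithDet n δ | IsDerogatory X} (orthogonalWithDet n δ) 3) ∧
    (Odd n → 3 ≤ n →
      HasCodimIn {X ∈ orthogonalWithDet n δ | IsDerogatory X} (orthogonalWithDet n δ) 1) ∧
    (Even n → 4 ≤ n → (δ = -1 → 6 ≤ n) →
      HasCodimIn {X ∈ orthogonalWithDet n δ | ∃ z : ℂ, z.im ≠ 0 ∧ IsDoubleEigenvalue X z}
        (orthogonalWithDet n δ) 3) ∧
    (Odd n → 3 ≤ n →
      HasCodimIn {X ∈ orthogonalWithDet n δ | ∃ z : ℂ, z ≠ -(δ : ℂ) ∧ IsDoubleEigenvalue X z}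
        (orthogonalWithDet n δ) 3) := by
  refine ⟨?_, ?_, ?_, ?_, ?_⟩
  · rintro hn hn2 rfl
    exact hasCodimIn_isDerogatory_of_even_of_det_eq_one hn hn2
  · rintro hn hn4 rfl
    exact hasCodimIn_isDerogatory_of_even_of_det_eq_neg_one hn hn4
  · exact hasCodimIn_isDerogatory_of_odd hδ
  · exact hasCodimIn_nonreal_doubleEigenvalueLocus hδ
  · exact hasCodimIn_ne_neg_det_doubleEigenvalueLocus hδ
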